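/- Let $\nu\ge 1$, let $\mathbf T^\nu=(\mathbf R/2\pi\mathbf Z)^\nu$ carry Lebesgue measure of the cube $(-\pi,\pi]^\nu$, and let $w_1,v_2,v_3,v_{21},v_{22}$ be real-valued continuous functions on $\mathbf T^\nu$, $w_2$ one on $(\mathbf T^\nu)^2$ and $w_3$ one on $(\mathbf T^\nu)^3$. All integrals below are over $\mathbf T^\nu$. Consider the following bounded operators. Channel operators: $H_1$ and $H_3$ act in $L_2((\mathbf T^\nu)^2)\oplus L_2((\mathbf T^\nu)^3)$ and $H_2$ acts in $L_2(\mathbf T^\nu)\oplus L_2((\mathbf T^\nu)^2)\oplus L_2((\mathbf T^\nu)^3)$ by $$H_3\begin{pmatrix}f_2\\ f_3\end{pmatrix}=\begin{pmatrix}w_2(p,q)f_2(p,q)+\int v_3(s)f_3(p,q,s)\,ds\\ v_3(t)f_2(p,q)+w_3(p,q,t)f_3(p,q,t)\end{pmatrix},$$ $$H_1\begin{pmatrix}f_2\\ f_3\end{pmatrix}=H_3\begin{pmatrix}f_2\\ f_3\end{pmatrix}-\begin{pmatrix}v_{21}(p)\int v_{21}(s)f_2(s,q)\,ds\\ 0\end{pmatrix},$$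 $$H_2\begin{pmatrix}f_1\\ f_2\\ f_3\end{pmatrix}=\begin{pmatrix}w_1(p)f_1(p)+\int v_2(s)f_2(p,s)\,ds\\ v_2(q)f_1(p)+w_2(p,q)f_2(p,q)-v_{22}(q)\int v_{22}(s)f_2(p,s)\,ds+\int v_3(s)f_3(p,q,s)\,ds\\ v_3(t)f_2(p,q)+w_3(p,q,t)f_3(p,q,t)\end{pmatrix}.$$ Fibre operators: for $p,q\in\mathbf T^\nu$ let $h_3(p,q)$ act in $\mathbf C\oplus L_2(\mathbf T^\nu)$, $h_1(p)$ in $L_2(\mathbf T^\nu)\oplus L_2((\mathbf T^\nu)^2)$ and $h_2(p)$ in $\mathbf C\oplus L_2(\mathbf T^\nu)\oplus L_2((\mathbf T^\nu)^2)$ by $$h_3(p,q)\begin{pmatrix}f_0\\ f_1\end{pmatrix}=\begin{pmatrix}w_2(p,q)f_0+\int v_3(s)f_1(s)\,ds\\ v_3(t)f_0+w_3(p,q,t)f_1(t)\end{pmatrix},$$ $$h_1(p)\begin{pmatrix}f_1\\ f_2\end{pmatrix}=\begin{pmatrix}w_2(q,p)f_1(q)-v_{21}(q)\int v_{21}(s)f_1(s)\,ds+\int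 v_3(s)f_2(q,s)\,ds\\ v_3(t)f_1(q)+w_3(q,p,t)f_2(q,t)\end{pmatrix},$$ $$h_2(p)\begin{pmatrix}f_0\\ f_1\\ f_2\end{pmatrix}=\begin{pmatrix}w_1(p)f_0+\int v_2(s)f_1(s)\,ds\\ v_2(q)f_0+w_2(p,q)f_1(q)-v_{22}(q)\int v_{22}(s)f_1(s)\,ds+\int v_3(s)f_2(q,s)\,ds\\ v_3(t)f_1(q)+w_3(p,q,t)f_2(q,t)\end{pmatrix}.$$ For one of these operators $A$, let $\sigma(A)\subset\mathbf C$ be its spectrum, $\sigma_{disc}(A)$ the set of eigenvalues of finite multiplicity that are isolated points of $\sigma(A)$, and $\sigma_{ess}(A)=\sigma(A)\setminus\sigma_{disc}(A)$. Then: (i) $\displaystyle\sigma(H_1)=\bigcup_{p}\sigma_{disc}(h_1(p))\ \cup\ \bigcup_{p,q}\sigma_{disc}(h_3(p,q))\ \cup\ [\min w_3,\max w_3]$; (ii) $\displaystyle\sigma(H_2)=\bigcup_{p}\sigma_{disc}(h_2(p))\ \cup\ \bigcup_{p,q}\sigma_{disc}(h_3(p,q))\ \cup\ [\min w_3,\max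 w_3]$; (iii) $\displaystyle\sigma(H_3)=\bigcup_{p,q}\sigma_{disc}(h_3(p,q))\ \cup\ [\min w_3,\max w_3]$. Moreover, put $$\Delta_3(p,q;z)=w_2(p,q)-z-\int\frac{v_3(s)^2\,ds}{w_3(p,q,s)-z},\qquad \Delta_1(p;z)=1-\int\frac{v_{21}(s)^2\,ds}{\Delta_3(s,p;z)},$$ $$\Delta_2(p;z)=\Bigl(1-\int\frac{v_{22}(s)^2\,ds}{\Delta_3(p,s;z)}\Bigr)\Bigl(w_1(p)-z-\int\frac{v_2(s)^2\,ds}{\Delta_3(p,s;z)}\Bigr)-\Bigl(\int\frac{v_2(s)v_{22}(s)\,ds}{\Delta_3(p,s;z)}\Bigr)^2 .$$ These are well defined for $z$ outside $\sigma_{ess}(h_3(p,q))$, $\sigma_{ess}(h_1(p))$ and $\sigma_{ess}(h_2(p))$ respectively, in the following sense: if $z\notin\sigma_{ess}(h_3(p,q))$, then $w_3(p,q,s)\ne z$ for all $s$; if $z\notin\sigma_{ess}(h_1(p))$, then $z\notin\sigma_{ess}(h_3(s,p))$ and $\Delta_3(s,p;z)\neq0$ for all $s$; if $z\notin\sigma_{ess}(h_2(p))$,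 then $z\notin\sigma_{ess}(h_3(p,s))$ and $\Delta_3(p,s;z)\ne0$ for all $s$. And for all $p,q\in\mathbf T^\nu$ $$\sigma_{disc}(h_3(p,q))=\{z\in\mathbf C\setminus\sigma_{ess}(h_3(p,q)):\Delta_3(p,q;z)=0\},$$ $$\sigma_{disc}(h_n(p))=\{z\in\mathbf C\setminus\sigma_{ess}(h_n(p)):\Delta_n(p;z)=0\},\qquad n=1,2.$$ -/

import Mathlib

open MeasureTheory Filter Topology

namespace FockModel

noncomputable section

/-! ### The torus and the `L₂` spaces -/

instance instFactTwoPiPos : Fact (0 < 2 * Real.pi) := ⟨Real.two_pi_pos⟩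

/-- The `ν`-dimensional torus `(ℝ / 2πℤ)^ν`. Its `volume` is the product of the Haar measures of
total mass `2π`, that is, Lebesgue measure on the cube `(-π, π]^ν`. -/
abbrev Torus (ν : ℕ) : Type := Fin ν → AddCircle (2 * Real.pi)

instance instBorelSpaceTorus (ν : ℕ) : BorelSpace (Torus ν) := Pi.borelSpace

instance instSecondCountableTorus (ν : ℕ) : SecondCountableTopology (Torus ν) := inferInstance

instance instBorelSpaceTorus₂ (ν : ℕ) : BorelSpace (Torus ν × Torus ν) := Prod.borelSpace

instance instBorelSpaceTorus₃ (ν : ℕ) : BorelSpace ((Torus ν × Torus ν) × Torus ν) :=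
  Prod.borelSpace

/-- `L₂(X)`: the Hilbert space of square-integrable complex functions on `X`. -/
abbrev L2 (X : Type*) [MeasureSpace X] : Type _ := Lp ℂ 2 (volume : Measure X)

/-- The orthogonal direct sum of two Hilbert spaces. -/
abbrev HSum (E F : Type*) : Type _ := WithLp 2 (E × F)

/-! ### Elementary operators -/

section Elementary

set_option linter.unusedSectionVars false

variable {X Y : Type*}
  [TopologicalSpace X] [CompactSpace X] [SecondCountableTopology X]
  [MeasureSpace X] [BorelSpace X] [IsFiniteMeasure (volume : Measure X)]
  [TopologicalSpace Y] [CompactSpace Y] [SecondCountableTopology Y]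
  [MeasureSpace Y] [BorelSpace Y] [IsFiniteMeasure (volume : Measure Y)]

theorem aestronglyMeasurable_coeff (w : C(X, ℝ)) :
    AEStronglyMeasurable (fun x => (w x : ℂ)) (volume : Measure X) :=
  (by fun_prop : Continuous fun x => (w x : ℂ)).aestronglyMeasurable

theorem norm_coeff_le (w : C(X, ℝ)) (x : X) : ‖(w x : ℂ)‖ ≤ ‖w‖ := by
  rw [Complex.norm_real]; exact w.norm_coe_le_norm x

theorem memLp_coeff (w : C(X, ℝ)) : MemLp (fun x => (w x : ℂ)) 2 (volume : Measure X) :=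
  MemLp.of_bound (aestronglyMeasurable_coeff w) ‖w‖ (Eventually.of_forall (norm_coeff_le w))

theorem memLp_mul (w : C(X, ℝ)) (f : L2 X) : MemLp (fun x => (w x : ℂ) * f x) 2 volume := by
  refine MemLp.of_le_mul (c := ‖w‖) (Lp.memLp f)
    ((aestronglyMeasurable_coeff w).mul (Lp.aestronglyMeasurable f)) ?_
  filter_upwards with x
  rw [norm_mul]
  gcongr
  exact norm_coeff_le w x

/-- Multiplication by a real continuous function: `f ↦ (x ↦ w(x) f(x))`. -/
def mulOp (w : C(X, ℝ)) : L2 X →L[ℂ] L2 X :=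
  LinearMap.mkContinuous
    { toFun := fun f => (memLp_mul w f).toLp (fun x => (w x : ℂ) * f x)
      map_add' := by
        intro f g
        rw [← MemLp.toLp_add]
        refine MemLp.toLp_congr _ _ ?_
        filter_upwards [Lp.coeFn_add f g] with x hx
        simp only [Pi.add_apply] at hx ⊢
        rw [hx, mul_add]
      map_smul' := by
        intro c f
        rw [RingHom.id_apply, ← MemLp.toLp_const_smul]
        refine MemLp.toLp_congr _ _ ?_
        filter_upwards [Lp.coeFn_smul c f] with x hx
        simp [hx, mul_left_comm] }
    ‖w‖
    (by
      intro f
      refine Lp.norm_le_mul_norm_of_ae_le_mul ?_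
      filter_upwards [MemLp.coeFn_toLp (memLp_mul w f)] with x hx
      simp only [LinearMap.coe_mk, AddHom.coe_mk]
      rw [hx, norm_mul]
      gcongr
      exact norm_coeff_le w x)

/-- Creation of one particle out of the vacuum sector: `c ↦ (y ↦ v(y) c)`. -/
def create₀ (v : C(Y, ℝ)) : ℂ →L[ℂ] L2 Y :=
  ContinuousLinearMap.toSpanSingleton ℂ ((memLp_coeff v).toLp (fun y => (v y : ℂ)))

theorem integrable_coeff_mul (v : C(Y, ℝ)) {f : Y → ℂ} (hf : MemLp f 2 volume) :
    Integrable (fun y => (v y : ℂ) * f y) volume :=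
  (memLp_coeff v).integrable_mul hf

theorem enorm_integral_le (v : C(Y, ℝ)) {f : Y → ℂ}
    (hf : AEStronglyMeasurable f (volume : Measure Y)) :
    ‖∫ y, (v y : ℂ) * f y‖ₑ ≤ eLpNorm (fun y => (v y : ℂ)) 2 volume * eLpNorm f 2 volume := by
  refine (enorm_integral_le_lintegral_enorm _).trans ?_
  have h := eLpNorm_smul_le_mul_eLpNorm (p := 2) (q := 2) (r := 1) hf
    (aestronglyMeasurable_coeff v)
  rw [eLpNorm_one_eq_lintegral_enorm] at h
  exact h

/-- The Cauchy-Schwarz inequality in the form used for annihilation operators. -/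
theorem enorm_integral_sq_le (v : C(Y, ℝ)) {f : Y → ℂ}
    (hf : AEStronglyMeasurable f (volume : Measure Y)) :
    ‖∫ y, (v y : ℂ) * f y‖ₑ ^ (2 : ℝ) ≤
      eLpNorm (fun y => (v y : ℂ)) 2 volume ^ (2 : ℝ) * ∫⁻ y, ‖f y‖ₑ ^ (2 : ℝ) := by
  have h1 := enorm_integral_le v hf
  refine (ENNReal.rpow_le_rpow h1 (by norm_num)).trans ?_
  rw [ENNReal.mul_rpow_of_nonneg _ _ (by norm_num)]
  gcongr
  rw [eLpNorm_eq_lintegral_rpow_enorm_toReal (by norm_num) (by norm_num)]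
  simp only [ENNReal.toReal_ofNat]
  rw [← ENNReal.rpow_mul]
  norm_num

/-- Annihilation of one particle into the vacuum sector: `f ↦ ∫ v(s) f(s) ds`. -/
def annih₀ (v : C(Y, ℝ)) : L2 Y →L[ℂ] ℂ :=
  LinearMap.mkContinuous
    { toFun := fun f => ∫ s, (v s : ℂ) * f s
      map_add' := by
        intro f g
        rw [← integral_add (integrable_coeff_mul v (Lp.memLp f))
          (integrable_coeff_mul v (Lp.memLp g))]
        refine integral_congr_ae ?_
        filter_upwards [Lp.coeFn_add f g] with x hx
        simp only [Pi.add_apply] at hx ⊢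
        rw [hx, mul_add]
      map_smul' := by
        intro c f
        rw [RingHom.id_apply, ← integral_smul]
        refine integral_congr_ae ?_
        filter_upwards [Lp.coeFn_smul c f] with x hx
        simp [hx, mul_left_comm] }
    (eLpNorm (fun y => (v y : ℂ)) 2 (volume : Measure Y)).toReal
    (by
      intro f
      simp only [LinearMap.coe_mk, AddHom.coe_mk]
      have h := enorm_integral_le v (Lp.aestronglyMeasurable f)
      have h2 := ENNReal.toReal_mono
        (ENNReal.mul_ne_top (memLp_coeff v).eLpNorm_ne_top (Lp.memLp f).eLpNorm_ne_top) h
      rwa [ENNReal.toReal_mul, toReal_enorm, ← Lp.norm_def] at h2)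

theorem memLp_create (v : C(Y, ℝ)) (f : L2 X) :
    MemLp (fun z : X × Y => (v z.2 : ℂ) * f z.1) 2 volume := by
  have hf : MemLp (fun z : X × Y => f z.1) 2 volume :=
    (Lp.memLp f).comp_fst (volume : Measure Y)
  refine MemLp.of_le_mul (c := ‖v‖) hf
    ((by fun_prop : Continuous fun z : X × Y => (v z.2 : ℂ)).aestronglyMeasurable.mul hf.1) ?_
  filter_upwards with z
  rw [norm_mul]
  gcongr
  exact norm_coeff_le v z.2

theorem ae_fst {P : X → Prop} (h : ∀ᵐ x, P x) : ∀ᵐ z : X × Y, P z.1 :=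
  Measure.quasiMeasurePreserving_fst.ae h

theorem lintegral_fst (g : L2 X) :
    eLpNorm (fun z : X × Y => g z.1) 2 volume =
      (volume (Set.univ : Set Y)) ^ (1 / 2 : ℝ) * eLpNorm g 2 volume := by
  have hm : AEMeasurable (fun x => ‖g x‖ₑ ^ (2 : ℝ)) (volume : Measure X) :=
    (Lp.aestronglyMeasurable g).enorm.pow_const _
  rw [eLpNorm_eq_lintegral_rpow_enorm_toReal (by norm_num) (by norm_num),
    eLpNorm_eq_lintegral_rpow_enorm_toReal (by norm_num) (by norm_num)]
  simp only [ENNReal.toReal_ofNat]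
  rw [Measure.volume_eq_prod, lintegral_prod _
    (show AEMeasurable (fun z : X × Y => ‖g z.1‖ₑ ^ (2 : ℝ)) (volume.prod volume) from
      hm.comp_quasiMeasurePreserving Measure.quasiMeasurePreserving_fst)]
  simp only [lintegral_const]
  rw [lintegral_mul_const'' _ hm, ENNReal.mul_rpow_of_nonneg _ _ (by norm_num), mul_comm]

/-- Creation operator `L₂(X) → L₂(X × Y)`: `f ↦ ((x, y) ↦ v(y) f(x))`. -/
def create (v : C(Y, ℝ)) : L2 X →L[ℂ] L2 (X × Y) :=
  LinearMap.mkContinuous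
    { toFun := fun f => (memLp_create v f).toLp (fun z : X × Y => (v z.2 : ℂ) * f z.1)
      map_add' := by
        intro f g
        rw [← MemLp.toLp_add]
        refine MemLp.toLp_congr _ _ ?_
        filter_upwards [ae_fst (Lp.coeFn_add f g)] with x hx
        simp only [Pi.add_apply] at hx ⊢
        rw [hx, mul_add]
      map_smul' := by
        intro c f
        rw [RingHom.id_apply, ← MemLp.toLp_const_smul]
        refine MemLp.toLp_congr _ _ ?_
        filter_upwards [ae_fst (Lp.coeFn_smul c f)] with x hx
        simp [hx, mul_left_comm] }
    (‖v‖ * ((volume (Set.univ : Set Y)) ^ (1 / 2 : ℝ)).toReal)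
    (by
      intro f
      have hf : MemLp (fun z : X × Y => f z.1) 2 volume :=
        (Lp.memLp f).comp_fst (volume : Measure Y)
      have h1 : ‖(memLp_create v f).toLp (fun z : X × Y => (v z.2 : ℂ) * f z.1)‖ ≤
          ‖v‖ * ‖hf.toLp (fun z : X × Y => f z.1)‖ := by
        refine Lp.norm_le_mul_norm_of_ae_le_mul ?_
        filter_upwards [MemLp.coeFn_toLp (memLp_create v f), MemLp.coeFn_toLp hf] with z h1 h2
        rw [h1, h2, norm_mul]
        gcongr
        exact norm_coeff_le v z.2
      refine h1.trans (le_of_eq ?_)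
      rw [Lp.norm_toLp, lintegral_fst, ENNReal.toReal_mul, ← Lp.norm_def, mul_assoc])

theorem ae_slice {P : X × Y → Prop} (h : ∀ᵐ z, P z) : ∀ᵐ x, ∀ᵐ y, P (x, y) :=
  Measure.ae_ae_of_ae_prod h

theorem lintegral_slice (f : L2 (X × Y)) :
    ∫⁻ x, ∫⁻ y, ‖f (x, y)‖ₑ ^ (2 : ℝ) = eLpNorm f 2 volume ^ (2 : ℝ) := by
  rw [eLpNorm_eq_lintegral_rpow_enorm_toReal (by norm_num) (by norm_num)]
  simp only [ENNReal.toReal_ofNat]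
  rw [← ENNReal.rpow_mul]
  have h := lintegral_prod (μ := (volume : Measure X)) (ν := (volume : Measure Y))
    (fun z : X × Y => ‖f z‖ₑ ^ (2 : ℝ)) ((Lp.aestronglyMeasurable f).enorm.pow_const _)
  rw [← h]
  norm_num
  rfl

theorem memLp_slice (f : L2 (X × Y)) : ∀ᵐ x, MemLp (fun y => f (x, y)) 2 volume := by
  have hm : AEMeasurable (fun z : X × Y => ‖f z‖ₑ ^ (2 : ℝ)) (volume.prod volume) :=
    (Lp.aestronglyMeasurable f).enorm.pow_const _
  have hfin : ∫⁻ x, ∫⁻ y, ‖f (x, y)‖ₑ ^ (2 : ℝ) ≠ ⊤ := by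
    rw [lintegral_slice]
    exact ENNReal.rpow_ne_top_of_nonneg (by norm_num) (Lp.memLp f).eLpNorm_ne_top
  filter_upwards [ae_lt_top' hm.lintegral_prod_right' hfin,
    (Lp.aestronglyMeasurable f).prodMk_left] with x h1 h2
  refine ⟨h2, ?_⟩
  rw [eLpNorm_lt_top_iff_lintegral_rpow_enorm_lt_top (by norm_num) (by norm_num)]
  simpa using h1

theorem eLpNorm_annih_le (v : C(Y, ℝ)) (f : L2 (X × Y)) :
    eLpNorm (fun x => ∫ s, (v s : ℂ) * f (x, s)) 2 (volume : Measure X) ≤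
      eLpNorm (fun y => (v y : ℂ)) 2 (volume : Measure Y) * eLpNorm f 2 volume := by
  have key : ∫⁻ x, ‖∫ s, (v s : ℂ) * f (x, s)‖ₑ ^ (2 : ℝ) ≤
      (eLpNorm (fun y => (v y : ℂ)) 2 (volume : Measure Y) * eLpNorm f 2 volume) ^ (2 : ℝ) := by
    rw [ENNReal.mul_rpow_of_nonneg _ _ (by norm_num), ← lintegral_slice f,
      ← lintegral_const_mul' _ _
        (ENNReal.rpow_ne_top_of_nonneg (by norm_num) (memLp_coeff v).eLpNorm_ne_top)]
    refine lintegral_mono_ae ?_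
    filter_upwards [memLp_slice f] with x hx
    exact enorm_integral_sq_le v hx.1
  rw [eLpNorm_eq_lintegral_rpow_enorm_toReal (by norm_num) (by norm_num)]
  simp only [ENNReal.toReal_ofNat]
  refine (ENNReal.rpow_le_rpow key (by norm_num)).trans (le_of_eq ?_)
  rw [← ENNReal.rpow_mul]
  norm_num

theorem memLp_annih (v : C(Y, ℝ)) (f : L2 (X × Y)) :
    MemLp (fun x => ∫ s, (v s : ℂ) * f (x, s)) 2 (volume : Measure X) := by
  refine ⟨?_, (eLpNorm_annih_le v f).trans_lt
    (ENNReal.mul_lt_top (memLp_coeff v).eLpNorm_lt_top (Lp.memLp f).eLpNorm_lt_top)⟩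
  have h : AEStronglyMeasurable (fun z : X × Y => (v z.2 : ℂ) * f z) (volume.prod volume) :=
    (by fun_prop : Continuous fun z : X × Y => (v z.2 : ℂ)).aestronglyMeasurable.mul
      (Lp.aestronglyMeasurable f)
  exact h.integral_prod_right'

/-- Annihilation operator `L₂(X × Y) → L₂(X)`: `f ↦ (x ↦ ∫ v(s) f(x, s) ds)`. -/
def annih (v : C(Y, ℝ)) : L2 (X × Y) →L[ℂ] L2 X :=
  LinearMap.mkContinuous
    { toFun := fun f => (memLp_annih v f).toLp (fun x => ∫ s, (v s : ℂ) * f (x, s))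
      map_add' := by
        intro f g
        rw [← MemLp.toLp_add]
        refine MemLp.toLp_congr _ _ ?_
        filter_upwards [ae_slice (Lp.coeFn_add f g), memLp_slice f, memLp_slice g]
          with x hx hf hg
        rw [Pi.add_apply, ← integral_add (integrable_coeff_mul v hf) (integrable_coeff_mul v hg)]
        refine integral_congr_ae ?_
        filter_upwards [hx] with y hy
        simp only [Pi.add_apply] at hy ⊢
        rw [hy, mul_add]
      map_smul' := by
        intro c f
        rw [RingHom.id_apply, ← MemLp.toLp_const_smul]
        refine MemLp.toLp_congr _ _ ?_
        filter_upwards [ae_slice (Lp.coeFn_smul c f)] with x hx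
        rw [Pi.smul_apply, ← integral_smul]
        refine integral_congr_ae ?_
        filter_upwards [hx] with y hy
        simp [hy, mul_left_comm] }
    (eLpNorm (fun y => (v y : ℂ)) 2 (volume : Measure Y)).toReal
    (by
      intro f
      simp only [LinearMap.coe_mk, AddHom.coe_mk]
      rw [Lp.norm_toLp, Lp.norm_def, ← ENNReal.toReal_mul]
      exact ENNReal.toReal_mono
        (ENNReal.mul_ne_top (memLp_coeff v).eLpNorm_ne_top (Lp.memLp f).eLpNorm_ne_top)
        (eLpNorm_annih_le v f))

/-- Exchange of the two variables, `f ↦ ((y, x) ↦ f(x, y))`. -/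
def swapOp : L2 (X × Y) →L[ℂ] L2 (Y × X) :=
  (Lp.compMeasurePreservingₗᵢ ℂ (Prod.swap : Y × X → X × Y)
    Measure.measurePreserving_swap).toContinuousLinearMap

end Elementary

/-! ### Operator matrices -/

section Matrices

variable {E F G : Type*} [NormedAddCommGroup E] [NormedSpace ℂ E]
  [NormedAddCommGroup F] [NormedSpace ℂ F] [NormedAddCommGroup G] [NormedSpace ℂ G]

/-- The operator matrix `[[A, B], [C, D]]` on `E ⊕ F`:
`(x, y) ↦ (A x + B y, C x + D y)`. -/
def block₂ (A : E →L[ℂ] E) (B : F →L[ℂ] E) (C : E →L[ℂ] F) (D : F →L[ℂ] F) :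
    HSum E F →L[ℂ] HSum E F :=
  (WithLp.prodContinuousLinearEquiv 2 ℂ E F).symm.toContinuousLinearMap ∘L
    ((A ∘L WithLp.fstL 2 ℂ E F + B ∘L WithLp.sndL 2 ℂ E F).prod
      (C ∘L WithLp.fstL 2 ℂ E F + D ∘L WithLp.sndL 2 ℂ E F))

/-- The tridiagonal operator matrix `[[A, B, 0], [C, D, B'], [0, C', D']]` on `E ⊕ F ⊕ G`:
`(x, y, z) ↦ (A x + B y, C x + D y + B' z, C' y + D' z)`. -/
def block₃ (A : E →L[ℂ] E) (B : F →L[ℂ] E) (C : E →L[ℂ] F) (D : F →L[ℂ] F)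
    (B' : G →L[ℂ] F) (C' : F →L[ℂ] G) (D' : G →L[ℂ] G) :
    HSum E (HSum F G) →L[ℂ] HSum E (HSum F G) :=
  block₂ A (B ∘L WithLp.fstL 2 ℂ F G)
    ((WithLp.prodContinuousLinearEquiv 2 ℂ F G).symm.toContinuousLinearMap ∘L C.prod 0)
    (block₂ D B' C' D')

end Matrices

/-! ### Discrete and essential spectrum of a (self-adjoint) operator -/

section Spectra

variable {E : Type*} [NormedAddCommGroup E] [NormedSpace ℂ E]

/-- The discrete spectrum: the eigenvalues of finite multiplicity that are isolated points of the
spectrum. -/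
def discSpectrum (A : E →L[ℂ] E) : Set ℂ :=
  {z | z ∈ spectrum ℂ A ∧ ¬ AccPt z (𝓟 (spectrum ℂ A)) ∧
    Module.End.HasEigenvalue (A : E →ₗ[ℂ] E) z ∧
    FiniteDimensional ℂ (Module.End.eigenspace (A : E →ₗ[ℂ] E) z)}

/-- The essential spectrum: the complement of the discrete spectrum in the spectrum. -/
def essSpectrum (A : E →L[ℂ] E) : Set ℂ := spectrum ℂ A \ discSpectrum A

end Spectra

/-! ### The channel operators -/

section Channel

variable {ν : ℕ}

/-- `(V₂₁ f)(p, q) = v₂₁(p) ∫ v₂₁(s) f(s, q) ds`. -/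
def V21 (v₂₁ : C(Torus ν, ℝ)) : L2 (Torus ν × Torus ν) →L[ℂ] L2 (Torus ν × Torus ν) :=
  swapOp ∘L create v₂₁ ∘L annih v₂₁ ∘L swapOp

/-- `(V₂₂ f)(p, q) = v₂₂(q) ∫ v₂₂(s) f(p, s) ds`. -/
def V22 (v₂₂ : C(Torus ν, ℝ)) : L2 (Torus ν × Torus ν) →L[ℂ] L2 (Torus ν × Torus ν) :=
  create v₂₂ ∘L annih v₂₂

/-- The channel operator `H₁ = [[H₂₂⁰ - V₂₁, H₂₃], [H₃₂, H₃₃]]` on `L₂(𝕋²) ⊕ L₂(𝕋³)`. -/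
def H1 (w₂ : C(Torus ν × Torus ν, ℝ)) (w₃ : C((Torus ν × Torus ν) × Torus ν, ℝ))
    (v₂₁ v₃ : C(Torus ν, ℝ)) :
    HSum (L2 (Torus ν × Torus ν)) (L2 ((Torus ν × Torus ν) × Torus ν)) →L[ℂ]
      HSum (L2 (Torus ν × Torus ν)) (L2 ((Torus ν × Torus ν) × Torus ν)) :=
  block₂ (mulOp w₂ - V21 v₂₁) (annih v₃) (create v₃) (mulOp w₃)

/-- The channel operator `H₂ = [[H₁₁, H₁₂, 0], [H₂₁, H₂₂⁰ - V₂₂, H₂₃], [0, H₃₂, H₃₃]]` on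
`L₂(𝕋) ⊕ L₂(𝕋²) ⊕ L₂(𝕋³)`. -/
def H2 (w₁ : C(Torus ν, ℝ)) (w₂ : C(Torus ν × Torus ν, ℝ))
    (w₃ : C((Torus ν × Torus ν) × Torus ν, ℝ)) (v₂ v₂₂ v₃ : C(Torus ν, ℝ)) :
    HSum (L2 (Torus ν)) (HSum (L2 (Torus ν × Torus ν)) (L2 ((Torus ν × Torus ν) × Torus ν)))
      →L[ℂ]
    HSum (L2 (Torus ν)) (HSum (L2 (Torus ν × Torus ν)) (L2 ((Torus ν × Torus ν) × Torus ν))) :=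
  block₃ (mulOp w₁) (annih v₂) (create v₂) (mulOp w₂ - V22 v₂₂) (annih v₃) (create v₃) (mulOp w₃)

/-- The channel operator `H₃ = [[H₂₂⁰, H₂₃], [H₃₂, H₃₃]]` on `L₂(𝕋²) ⊕ L₂(𝕋³)`. -/
def H3 (w₂ : C(Torus ν × Torus ν, ℝ)) (w₃ : C((Torus ν × Torus ν) × Torus ν, ℝ))
    (v₃ : C(Torus ν, ℝ)) :
    HSum (L2 (Torus ν × Torus ν)) (L2 ((Torus ν × Torus ν) × Torus ν)) →L[ℂ]
      HSum (L2 (Torus ν × Torus ν)) (L2 ((Torus ν × Torus ν) × Torus ν)) :=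
  block₂ (mulOp w₂) (annih v₃) (create v₃) (mulOp w₃)

/-! ### The fibre operators -/

/-- The generalized Friedrichs model `h₃(p, q)` on `ℂ ⊕ L₂(𝕋)`:
`(f₀, f₁) ↦ (w₂(p,q) f₀ + ∫ v₃(s) f₁(s) ds, v₃(t) f₀ + w₃(p,q,t) f₁(t))`. -/
def h3 (w₂ : C(Torus ν × Torus ν, ℝ)) (w₃ : C((Torus ν × Torus ν) × Torus ν, ℝ))
    (v₃ : C(Torus ν, ℝ)) (p q : Torus ν) :
    HSum ℂ (L2 (Torus ν)) →L[ℂ] HSum ℂ (L2 (Torus ν)) :=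
  block₂ ((w₂ (p, q) : ℂ) • ContinuousLinearMap.id ℂ ℂ) (annih₀ v₃) (create₀ v₃)
    (mulOp ⟨fun t => w₃ ((p, q), t), by fun_prop⟩)

/-- The fibre `h₁(p)` on `L₂(𝕋) ⊕ L₂(𝕋²)` of `H₁`; since `V₂₁` acts on the first variable, `p` is
the (conserved) second variable of `w₂` and `w₃`:
`(f₁, f₂) ↦ (w₂(q,p) f₁(q) - v₂₁(q) ∫ v₂₁(s) f₁(s) ds + ∫ v₃(s) f₂(q,s) ds,
  v₃(t) f₁(q) + w₃(q,p,t) f₂(q,t))`. -/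
def h1 (w₂ : C(Torus ν × Torus ν, ℝ)) (w₃ : C((Torus ν × Torus ν) × Torus ν, ℝ))
    (v₂₁ v₃ : C(Torus ν, ℝ)) (p : Torus ν) :
    HSum (L2 (Torus ν)) (L2 (Torus ν × Torus ν)) →L[ℂ]
      HSum (L2 (Torus ν)) (L2 (Torus ν × Torus ν)) :=
  block₂ (mulOp ⟨fun q => w₂ (q, p), by fun_prop⟩ - create₀ v₂₁ ∘L annih₀ v₂₁)
    (annih v₃) (create v₃) (mulOp ⟨fun x => w₃ ((x.1, p), x.2), by fun_prop⟩)

/-- The fibre `h₂(p)` on `ℂ ⊕ L₂(𝕋) ⊕ L₂(𝕋²)` of `H₂`: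
`(f₀, f₁, f₂) ↦ (w₁(p) f₀ + ∫ v₂(s) f₁(s) ds,
  v₂(q) f₀ + w₂(p,q) f₁(q) - v₂₂(q) ∫ v₂₂(s) f₁(s) ds + ∫ v₃(s) f₂(q,s) ds,
  v₃(t) f₁(q) + w₃(p,q,t) f₂(q,t))`. -/
def h2 (w₁ : C(Torus ν, ℝ)) (w₂ : C(Torus ν × Torus ν, ℝ))
    (w₃ : C((Torus ν × Torus ν) × Torus ν, ℝ)) (v₂ v₂₂ v₃ : C(Torus ν, ℝ)) (p : Torus ν) :
    HSum ℂ (HSum (L2 (Torus ν)) (L2 (Torus ν × Torus ν))) →L[ℂ]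
      HSum ℂ (HSum (L2 (Torus ν)) (L2 (Torus ν × Torus ν))) :=
  block₃ ((w₁ p : ℂ) • ContinuousLinearMap.id ℂ ℂ) (annih₀ v₂) (create₀ v₂)
    (mulOp ⟨fun q => w₂ (p, q), by fun_prop⟩ - create₀ v₂₂ ∘L annih₀ v₂₂)
    (annih v₃) (create v₃) (mulOp ⟨fun x => w₃ ((p, x.1), x.2), by fun_prop⟩)

/-! ### The Fredholm determinants -/

/-- `Δ₃(p, q; z) = w₂(p,q) - z - ∫ v₃(s)² / (w₃(p,q,s) - z) ds`. -/
def Δ3 (w₂ : C(Torus ν × Torus ν, ℝ)) (w₃ : C((Torus ν × Torus ν) × Torus ν, ℝ))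
    (v₃ : C(Torus ν, ℝ)) (p q : Torus ν) (z : ℂ) : ℂ :=
  (w₂ (p, q) : ℂ) - z - ∫ s, (v₃ s : ℂ) ^ 2 / ((w₃ ((p, q), s) : ℂ) - z)

/-- `Δ₁(p; z) = 1 - ∫ v₂₁(s)² / Δ₃(s, p; z) ds`. -/
def Δ1 (w₂ : C(Torus ν × Torus ν, ℝ)) (w₃ : C((Torus ν × Torus ν) × Torus ν, ℝ))
    (v₂₁ v₃ : C(Torus ν, ℝ)) (p : Torus ν) (z : ℂ) : ℂ :=
  1 - ∫ s, (v₂₁ s : ℂ) ^ 2 / Δ3 w₂ w₃ v₃ s p z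

/-- `Δ₂(p; z) = (1 - ∫ v₂₂(s)² / Δ₃(p,s;z) ds) (w₁(p) - z - ∫ v₂(s)² / Δ₃(p,s;z) ds)
  - (∫ v₂(s) v₂₂(s) / Δ₃(p,s;z) ds)²`. -/
def Δ2 (w₁ : C(Torus ν, ℝ)) (w₂ : C(Torus ν × Torus ν, ℝ))
    (w₃ : C((Torus ν × Torus ν) × Torus ν, ℝ)) (v₂ v₂₂ v₃ : C(Torus ν, ℝ))
    (p : Torus ν) (z : ℂ) : ℂ :=
  (1 - ∫ s, (v₂₂ s : ℂ) ^ 2 / Δ3 w₂ w₃ v₃ p s z) *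
      ((w₁ p : ℂ) - z - ∫ s, (v₂ s : ℂ) ^ 2 / Δ3 w₂ w₃ v₃ p s z)
    - (∫ s, (v₂ s : ℂ) * (v₂₂ s : ℂ) / Δ3 w₂ w₃ v₃ p s z) ^ 2

/-! ### The branches of the spectrum -/

/-- The four-particle branch, the segment `[min w₃, max w₃]` of the real axis in `ℂ` (`w₃` is
continuous on a non-empty compact space, so both extrema are attained). -/
def sigmaFour (w₃ : C((Torus ν × Torus ν) × Torus ν, ℝ)) : Set ℂ :=
  (fun x : ℝ => (x : ℂ)) '' Set.Icc (⨅ x, w₃ x) (⨆ x, w₃ x)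

/-- The three-particle branch `⋃_{p,q} σ_disc(h₃(p, q))`. -/
def sigmaThree (w₂ : C(Torus ν × Torus ν, ℝ)) (w₃ : C((Torus ν × Torus ν) × Torus ν, ℝ))
    (v₃ : C(Torus ν, ℝ)) : Set ℂ :=
  ⋃ (p : Torus ν) (q : Torus ν), discSpectrum (h3 w₂ w₃ v₃ p q)

/-- The two-particle branch `⋃_p σ_disc(h₁(p))` of `H₁`. -/
def sigmaTwoH1 (w₂ : C(Torus ν × Torus ν, ℝ)) (w₃ : C((Torus ν × Torus ν) × Torus ν, ℝ))
    (v₂₁ v₃ : C(Torus ν, ℝ)) : Set ℂ :=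
  ⋃ p : Torus ν, discSpectrum (h1 w₂ w₃ v₂₁ v₃ p)

/-- The two-particle branch `⋃_p σ_disc(h₂(p))` of `H₂`. -/
def sigmaTwoH2 (w₁ : C(Torus ν, ℝ)) (w₂ : C(Torus ν × Torus ν, ℝ))
    (w₃ : C((Torus ν × Torus ν) × Torus ν, ℝ)) (v₂ v₂₂ v₃ : C(Torus ν, ℝ)) : Set ℂ :=
  ⋃ p : Torus ν, discSpectrum (h2 w₁ w₂ w₃ v₂ v₂₂ v₃ p)

end Channel

end

end FockModel

/-! Each channel operator is fibred over its conserved momenta, but no direct integral is needed: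
channel and fibre operators are both reduced, by the same Schur complements, to multiplication
operators and scalars.

Let `z` lie outside the range of `w₃`. Then `w₃ - z` is invertible, and eliminating the last
component turns the remaining block into multiplication by `Δ3`, minus the term with `v₂₁` or `v₂₂`
(`schur_complement_eq`). If `Δ3` has no zero either, inverting `M - c a` amounts to inverting `1 - a
M⁻¹ c` (`isUnit_sub_comp_iff`). For `H1` this is multiplication by `p ↦ Δ1(p; z)`, for `h1(p)` it is
the number `Δ1(p; z)`. For `H2` and `h2(p)` a 2×2 matrix with commuting entries appears, and its
determinant is `Δ2` (`isUnit_block₂_sub_comp_iff`). Multiplication by a continuous function is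
invertible iff the function has no zero, so `z` is in the spectrum of the channel operator iff it is
in the spectrum of some fibre.

Two criteria sort the spectrum of a self-adjoint `A`. If `A - z` is not bounded below on any
subspace of finite codimension, then `z` is essential (`IsSingular.mem_essSpectrum`). If `A - z` is
invertible plus compact and `z` is in the spectrum, then `z` is discrete
(`mem_discSpectrum_of_eq_add`). The first applies where `w₃ - z` or `Δ3` vanishes: functions
concentrated near the zero meet every subspace of finite codimension, and can be chosen in the
kernel of the annihilation operators that would interfere. The same test functions put these points
in the spectra of the channel operators. The second applies at all other points, where the `v₂₁` and
`v₂₂` terms of the fibres have rank at most one. -/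

namespace FockModel

/-! ### Singular operators -/

section Singular

variable {E F G : Type*} [NormedAddCommGroup E] [NormedSpace ℂ E]
  [NormedAddCommGroup F] [NormedSpace ℂ F] [NormedAddCommGroup G] [NormedSpace ℂ G]

/-- `T` is singular if it is not bounded below on any subspace of finite codimension. -/
def IsSingular (T : E →L[ℂ] F) : Prop :=
  ∀ ε > 0, ∀ N : Submodule ℂ E, N.CoFG → ∃ x ∈ N, x ≠ 0 ∧ ‖T x‖ ≤ ε * ‖x‖

theorem cofg_comap {N : Submodule ℂ F} (hN : N.CoFG) (J : E →ₗ[ℂ] F) : (N.comap J).CoFG := by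
  have : Module.Finite ℂ (F ⧸ N) := hN
  have h := Submodule.CoFG.ker (N.mkQ ∘ₗ J)
  rwa [LinearMap.ker_comp, Submodule.ker_mkQ] at h

theorem IsSingular.comp_left {T : E →L[ℂ] F} (hT : IsSingular T) (L : F →L[ℂ] G) :
    IsSingular (L ∘L T) := by
  intro ε hε N hN
  obtain ⟨x, hx, hx0, hle⟩ := hT (ε / (‖L‖ + 1)) (by positivity) N hN
  refine ⟨x, hx, hx0, ?_⟩
  calc ‖L (T x)‖ ≤ ‖L‖ * ‖T x‖ := L.le_opNorm _
    _ ≤ (‖L‖ + 1) * (ε / (‖L‖ + 1) * ‖x‖) := by gcongr; linarith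
    _ = ε * ‖x‖ := by field_simp

/-- Test vectors for `T` are sought in the image of `J`: the preimage of a subspace of finite
codimension has finite codimension, and `J` does not shrink norms. -/
theorem IsSingular.of_comp_right {T : F →L[ℂ] G} (J : E →L[ℂ] F) (hJ : ∀ x, ‖x‖ ≤ ‖J x‖)
    (hT : IsSingular (T ∘L J)) : IsSingular T := by
  intro ε hε N hN
  obtain ⟨x, hx, hx0, hle⟩ := hT ε hε (N.comap (J : E →ₗ[ℂ] F)) (cofg_comap hN _)
  refine ⟨J x, hx, ?_, hle.trans (by gcongr; exact hJ x)⟩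
  intro h0
  have := hJ x
  rw [h0, norm_zero] at this
  exact hx0 (norm_le_zero_iff.1 this)

theorem IsSingular.congr_of_cofg {S T : E →L[ℂ] F} (hS : IsSingular S)
    (h : (LinearMap.eqLocus (S : E →ₗ[ℂ] F) (T : E →ₗ[ℂ] F)).CoFG) : IsSingular T := by
  intro ε hε N hN
  obtain ⟨x, hx, hx0, hle⟩ := hS ε hε _ (hN.inf h)
  have hST : S x = T x := hx.2
  exact ⟨x, hx.1, hx0, hST ▸ hle⟩

/-- Singularity is stable under perturbations factoring through a finite-dimensional space. -/
theorem IsSingular.add_comp {S : E →L[ℂ] F} (hS : IsSingular S) [FiniteDimensional ℂ G]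
    (c : G →L[ℂ] F) (a : E →L[ℂ] G) : IsSingular (S + c ∘L a) := by
  refine hS.congr_of_cofg (Submodule.CoFG.of_le ?_ (Submodule.CoFG.ker (a : E →ₗ[ℂ] G)))
  intro x hx
  have hx' : a x = 0 := hx
  simp [hx']

/-- Unlike in `IsSingular.of_comp_right`, the map `J` producing test vectors may depend on `ε` and
needs no lower bound. -/
theorem IsSingular.comp_subtypeL_of_exists {T : F →L[ℂ] G} {V : Submodule ℂ F}
    (h : ∀ ε > 0, ∃ J : E →L[ℂ] F, (∀ x, J x ∈ V) ∧
      ∀ N : Submodule ℂ E, N.CoFG → ∃ x ∈ N, J x ≠ 0 ∧ ‖T (J x)‖ ≤ ε * ‖J x‖) :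
    IsSingular (T ∘L V.subtypeL) := by
  intro ε hε N hN
  obtain ⟨J, hJ, h⟩ := h ε hε
  obtain ⟨x, hx, hx0, hle⟩ := h _ (cofg_comap hN (J.codRestrict V hJ : E →ₗ[ℂ] V))
  exact ⟨⟨J x, hJ x⟩, hx, fun h0 => hx0 (congrArg Subtype.val h0), hle⟩

/-- On the kernel of `P`, a left inverse `S` modulo `P` would bound `T` from below. -/
theorem IsSingular.not_le {T : E →L[ℂ] F} (hT : IsSingular T) {S : F →L[ℂ] E} {P : E →L[ℂ] E}
    (hP : (LinearMap.ker (P : E →ₗ[ℂ] E)).CoFG) : S ∘L T ≠ 1 - P := by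
  intro h
  -- This `ε` forces `‖S (T x)‖ ≤ ‖x‖ / 2`; the `+ 1` covers `S = 0`.
  obtain ⟨x, hx, hx0, hle⟩ := hT (1 / (2 * (‖S‖ + 1))) (by positivity) _ hP
  have hPx : P x = 0 := hx
  have h1 : S (T x) = x := by
    have := congrArg (fun R : E →L[ℂ] E => R x) h
    simpa [hPx] using this
  have h2 : ‖x‖ ≤ ‖x‖ / 2 := by
    calc ‖x‖ = ‖S (T x)‖ := by rw [h1]
      _ ≤ ‖S‖ * ‖T x‖ := S.le_opNorm _
      _ ≤ (‖S‖ + 1) * (1 / (2 * (‖S‖ + 1)) * ‖x‖) := by gcongr; linarith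
      _ = ‖x‖ / 2 := by field_simp
  have := norm_pos_iff.2 hx0
  linarith

theorem IsSingular.not_isUnit {T : E →L[ℂ] E} (hT : IsSingular T) : ¬ IsUnit T := by
  rintro ⟨u, rfl⟩
  refine hT.not_le (S := (↑u⁻¹ : E →L[ℂ] E)) (P := 0) ?_ ?_
  · rw [show LinearMap.ker ((0 : E →L[ℂ] E) : E →ₗ[ℂ] E) = ⊤ from by ext; simp]
    exact Submodule.CoFG.top
  · rw [sub_zero]
    exact u.inv_mul

theorem units_inv_apply_apply (u : (E →L[ℂ] E)ˣ) (x : E) :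
    (↑u⁻¹ : E →L[ℂ] E) ((u : E →L[ℂ] E) x) = x :=
  congrArg (fun R : E →L[ℂ] E => R x) u.inv_mul

theorem units_apply_inv_apply (u : (E →L[ℂ] E)ˣ) (x : E) :
    (u : E →L[ℂ] E) ((↑u⁻¹ : E →L[ℂ] E) x) = x :=
  congrArg (fun R : E →L[ℂ] E => R x) u.mul_inv

theorem mem_spectrum_iff_not_isUnit_sub (A : E →L[ℂ] E) (z : ℂ) :
    z ∈ spectrum ℂ A ↔ ¬ IsUnit (A - z • 1) := by
  rw [spectrum.mem_iff, Algebra.algebraMap_eq_smul_one, ← IsUnit.neg_iff, neg_sub]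

/-- On the eigenspace `U x = -K x`, so the compact operator `-U⁻¹ K` restricts to the identity
there, and a space with compact identity is finite-dimensional. -/
theorem finiteDimensional_eigenspace_of_eq_add {A U K : E →L[ℂ] E} {z : ℂ} (hU : IsUnit U)
    (hK : IsCompactOperator K) (h : A - z • 1 = U + K) :
    FiniteDimensional ℂ (Module.End.eigenspace (A : E →ₗ[ℂ] E) z) := by
  obtain ⟨u, rfl⟩ := hU
  have hc : IsCompactOperator (-((↑u⁻¹ : E →L[ℂ] E) ∘L K)) := (hK.clm_comp _).neg
  set V := Module.End.eigenspace (A : E →ₗ[ℂ] E) z with hV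
  have hclosed : IsClosed (V : Set E) := by
    have : (V : Set E) = {x | A x = z • x} := by
      ext x
      simp [hV]
    rw [this]
    exact isClosed_eq (by fun_prop) (by fun_prop)
  have hx : ∀ x ∈ V, (-((↑u⁻¹ : E →L[ℂ] E) ∘L K)) x = x := by
    intro x hx
    rw [hV, Module.End.mem_eigenspace_iff] at hx
    have h1 : (u : E →L[ℂ] E) x + K x = 0 := by
      have := congrArg (fun R : E →L[ℂ] E => R x) h
      have hx' : A x = z • x := hx
      simpa [hx'] using this.symm
    have h2 : (↑u⁻¹ : E →L[ℂ] E) ((u : E →L[ℂ] E) x) = x := units_inv_apply_apply u x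
    have h3 : K x = - (u : E →L[ℂ] E) x := (neg_eq_of_add_eq_zero_right h1).symm
    simp [h3, h2]
  have hmap : ∀ x ∈ V, ((-((↑u⁻¹ : E →L[ℂ] E) ∘L K) : E →L[ℂ] E) : E →ₗ[ℂ] E) x ∈ V := by
    intro x hxV
    change (-((↑u⁻¹ : E →L[ℂ] E) ∘L K)) x ∈ V
    rwa [hx x hxV]
  have hres := IsCompactOperator.restrict
    (f := ((-((↑u⁻¹ : E →L[ℂ] E) ∘L K) : E →L[ℂ] E) : E →ₗ[ℂ] E)) hc hmap hclosed
  refine FiniteDimensional.of_isCompactOperator_id (𝕜 := ℂ) ?_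
  exact (congrArg IsCompactOperator (funext fun x : V => Subtype.ext (hx x x.2))).mp hres

end Singular

/-! ### Discrete and essential spectrum of self-adjoint operators -/

section SelfAdjoint

variable {E : Type*} [NormedAddCommGroup E] [InnerProductSpace ℂ E] [CompleteSpace E]

/-- At a point of the discrete spectrum, a self-adjoint operator is invertible modulo a finite
rank operator. -/
theorem exists_leftInverse_mod_finiteRank {A : E →L[ℂ] E} (hA : IsSelfAdjoint A) {z : ℂ}
    (hz : z ∈ discSpectrum A) :
    ∃ S P : E →L[ℂ] E, (LinearMap.ker (P : E →ₗ[ℂ] E)).CoFG ∧ S ∘L (A - z • 1) = 1 - P := by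
  classical
  obtain ⟨-, hacc, -, hfin⟩ := hz
  have : IsStarNormal A := hA.isStarNormal
  have hiso : ∀ᶠ x in 𝓝[spectrum ℂ A] z, x = z := by
    rw [accPt_iff_frequently_nhdsNE, not_frequently] at hacc
    rw [eventually_nhdsWithin_iff] at hacc ⊢
    filter_upwards [hacc] with x hx hxs
    by_contra hne
    exact hx hne hxs
  -- As `z` is isolated in the spectrum, the value of `f` at `z` is irrelevant for continuity; this
  -- admits functions such as the indicator of `z` to the functional calculus.
  have hcont : ∀ f : ℂ → ℂ, (∀ x ≠ z, ContinuousAt f x) → ContinuousOn f (spectrum ℂ A) := by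
    intro f hf x _
    rcases eq_or_ne x z with rfl | hne
    · refine (continuousWithinAt_const (b := f x)).congr_of_eventuallyEq ?_ rfl
      filter_upwards [hiso] with y hy
      rw [hy]
    · exact (hf x hne).continuousWithinAt
  have hev : ∀ x ≠ z, ∀ᶠ y in 𝓝 x, y ≠ z := fun x hx => isOpen_ne.mem_nhds hx
  have hf : ContinuousOn (fun x : ℂ => if x = z then (1 : ℂ) else 0) (spectrum ℂ A) := by
    refine hcont _ fun x hx => ?_
    refine (continuousAt_const (y := (0 : ℂ))).congr ?_
    filter_upwards [hev x hx] with y hy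
    simp [hy]
  have hg : ContinuousOn (fun x : ℂ => (x - z)⁻¹) (spectrum ℂ A) := by
    refine hcont _ fun x hx => ?_
    exact ((continuousAt_id.sub continuousAt_const).inv₀ (sub_ne_zero.2 hx))
  have hl : ContinuousOn (fun x : ℂ => x - z) (spectrum ℂ A) := by fun_prop
  have hAz : cfc (fun x : ℂ => x - z) A = A - z • 1 := by
    rw [cfc_sub (fun x => x) (fun _ => z) A, cfc_id' ℂ A, cfc_const z A,
      Algebra.algebraMap_eq_smul_one]
  -- `P` is the spectral projection of `z`, with range in the finite-dimensional eigenspace. `S`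
  -- inverts `A - z` off `z`; at `z` its symbol is `0⁻¹ = 0`, whence `S (A - z) = 1 - P`.
  refine ⟨cfc (fun x : ℂ => (x - z)⁻¹) A, cfc (fun x : ℂ => if x = z then (1 : ℂ) else 0) A,
    ?_, ?_⟩
  · rw [← Submodule.range_fg_iff_ker_cofg]
    have hzero : (A - z • 1) * cfc (fun x : ℂ => if x = z then (1 : ℂ) else 0) A = 0 := by
      rw [← hAz, ← cfc_mul _ _ A hl hf, ← cfc_zero ℂ A]
      refine cfc_congr fun x _ => ?_
      by_cases h : x = z <;> simp [h]
    have hle : LinearMap.range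
        ((cfc (fun x : ℂ => if x = z then (1 : ℂ) else 0) A : E →L[ℂ] E) : E →ₗ[ℂ] E) ≤
        Module.End.eigenspace (A : E →ₗ[ℂ] E) z := by
      rintro _ ⟨x, rfl⟩
      rw [Module.End.mem_eigenspace_iff]
      have := congrArg (fun R : E →L[ℂ] E => R x) hzero
      simpa [sub_eq_zero] using this
    have := Submodule.finiteDimensional_of_le hle
    exact (Submodule.fg_top _).1 Module.Finite.fg_top
  · rw [← hAz]
    rw [← ContinuousLinearMap.mul_def, ← cfc_mul _ _ A hg hl, ← cfc_one ℂ A,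
      ← cfc_sub _ _ A (by fun_prop) hf]
    refine cfc_congr fun x _ => ?_
    by_cases h : x = z
    · simp [h]
    · simp [h, sub_ne_zero.2 h]

theorem IsSingular.mem_essSpectrum {A : E →L[ℂ] E} (hA : IsSelfAdjoint A) {z : ℂ}
    (hz : IsSingular (A - z • 1)) : z ∈ essSpectrum A := by
  refine ⟨(mem_spectrum_iff_not_isUnit_sub A z).2 hz.not_isUnit, fun hd => ?_⟩
  obtain ⟨S, P, hP, h⟩ := exists_leftInverse_mod_finiteRank hA hd
  exact hz.not_le hP h

/-- The Fredholm alternative for compact perturbations of invertible operators. -/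
theorem exists_ne_zero_of_not_isUnit_add {U K : E →L[ℂ] E} (hU : IsUnit U)
    (hK : IsCompactOperator K) (h : ¬ IsUnit (U + K)) : ∃ x ≠ 0, U x + K x = 0 := by
  obtain ⟨u, rfl⟩ := hU
  have hc : IsCompactOperator (-((↑u⁻¹ : E →L[ℂ] E) ∘L K)) := (hK.clm_comp _).neg
  rcases hc.hasEigenvalue_or_mem_resolventSet (one_ne_zero (α := ℂ)) with h1 | h1
  · obtain ⟨x, hx⟩ := h1.exists_hasEigenvector
    refine ⟨x, hx.2, ?_⟩
    have h2 : -((↑u⁻¹ : E →L[ℂ] E) (K x)) = x := by simpa using hx.apply_eq_smul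
    have h3 : (u : E →L[ℂ] E) ((↑u⁻¹ : E →L[ℂ] E) (K x)) = K x := units_apply_inv_apply u _
    rw [← h3, ← map_add]
    nth_rewrite 1 [← h2]
    simp
  · refine absurd ?_ h
    rw [spectrum.mem_resolventSet_iff] at h1
    have h2 : (u : E →L[ℂ] E) + K =
        u * (algebraMap ℂ (E →L[ℂ] E) 1 - -((↑u⁻¹ : E →L[ℂ] E) ∘L K)) := by
      rw [map_one, sub_neg_eq_add, mul_add, mul_one]
      congr 1
      change K = u * ((↑u⁻¹ : E →L[ℂ] E) * K)
      rw [← mul_assoc, u.mul_inv, one_mul]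
    rw [h2]
    exact u.isUnit.mul h1

/-- Suppose spectral points `y n ≠ z` tend to `z`. By the Fredholm alternative those near `z` are
eigenvalues, with unit eigenvectors `x n`. Compactness of `K` makes a subsequence of `x n` converge
to a unit eigenvector for `z`. Eigenvectors for distinct eigenvalues being orthogonal, this limit is
orthogonal to every `x n`, hence to itself. -/
theorem not_accPt_spectrum_of_eq_add {A U K : E →L[ℂ] E} (hA : IsSelfAdjoint A) {z : ℂ}
    (hU : IsUnit U) (hK : IsCompactOperator K) (h : A - z • 1 = U + K) :
    ¬ AccPt z (𝓟 (spectrum ℂ A)) := by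
  intro hacc
  have hev : ∀ᶠ y in 𝓝 z, IsUnit (U + (z - y) • (1 : E →L[ℂ] E)) := by
    have hc : ContinuousAt (fun y : ℂ => U + (z - y) • (1 : E →L[ℂ] E)) z := by fun_prop
    refine hc.eventually (Units.isOpen.mem_nhds ?_)
    simpa using hU
  have hfr : ∃ᶠ y in 𝓝 z, ∃ x : E, y ≠ z ∧ ‖x‖ = 1 ∧ A x = y • x := by
    rw [accPt_iff_frequently_nhdsNE] at hacc
    refine (frequently_nhdsWithin_iff.1 hacc).and_eventually hev |>.mono ?_
    rintro y ⟨⟨hy, hyz⟩, hyU⟩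
    rw [mem_spectrum_iff_not_isUnit_sub] at hy
    have hsplit : A - y • 1 = (U + (z - y) • (1 : E →L[ℂ] E)) + K := by
      rw [add_right_comm, ← h, sub_smul]
      abel
    rw [hsplit] at hy
    obtain ⟨x, hx0, hx⟩ := exists_ne_zero_of_not_isUnit_add hyU hK hy
    have hx' : A x = y • x := by
      have := congrArg (fun R : E →L[ℂ] E => R x) hsplit
      have h2 : A x - y • x = (U + (z - y) • (1 : E →L[ℂ] E)) x + K x := by simpa using this
      rw [hx] at h2
      exact sub_eq_zero.1 h2
    refine ⟨((‖x‖ : ℂ)⁻¹) • x, hyz, ?_, ?_⟩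
    · rw [norm_smul, norm_inv, Complex.norm_real, norm_norm,
        inv_mul_cancel₀ (norm_ne_zero_iff.2 hx0)]
    · rw [map_smul, hx', smul_comm]
  obtain ⟨y, hyz, hyx⟩ := exists_seq_forall_of_frequently hfr
  choose x hyne hx1 hx using hyx
  have hcpt := hK.isCompact_closure_image_closedBall 1
  obtain ⟨k, -, φ, hφ, hk⟩ := hcpt.tendsto_subseq (x := fun n => K (x n))
    (fun n => subset_closure ⟨x n, by simp [hx1 n], rfl⟩)
  have hyφ : Tendsto (fun n => y (φ n)) atTop (𝓝 z) := hyz.comp hφ.tendsto_atTop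
  have hsmall : Tendsto (fun n => (y (φ n) - z) • x (φ n)) atTop (𝓝 0) := by
    rw [tendsto_zero_iff_norm_tendsto_zero]
    have : Tendsto (fun n => ‖y (φ n) - z‖) atTop (𝓝 0) := by
      simpa using (hyφ.sub_const z).norm
    refine this.congr fun n => ?_
    rw [norm_smul, hx1, mul_one]
  have hAx : ∀ n, U (x n) + K (x n) = (y n - z) • x n := by
    intro n
    have := congrArg (fun R : E →L[ℂ] E => R (x n)) h
    have h2 : A (x n) - z • x n = U (x n) + K (x n) := by simpa using this
    rw [← h2, hx, sub_smul]
  obtain ⟨u, rfl⟩ := hU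
  -- Solve `U x + K x = (y - z) x` for `x = U⁻¹ ((y - z) x - K x)`, where both terms in the bracket
  -- converge.
  have hlim : Tendsto (fun n => x (φ n)) atTop (𝓝 ((↑u⁻¹ : E →L[ℂ] E) (0 - k))) := by
    have h1 : Tendsto (fun n => (y (φ n) - z) • x (φ n) - K (x (φ n))) atTop (𝓝 (0 - k)) :=
      hsmall.sub hk
    refine (((↑u⁻¹ : E →L[ℂ] E).continuous.tendsto _).comp h1).congr fun n => ?_
    simp only [Function.comp_apply]
    rw [← hAx, add_sub_cancel_right, units_inv_apply_apply]
  set w := (↑u⁻¹ : E →L[ℂ] E) (0 - k)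
  have hw1 : ‖w‖ = 1 :=
    tendsto_nhds_unique hlim.norm (by simp [hx1])
  have hwA : A w = z • w := by
    refine tendsto_nhds_unique ((A.continuous.tendsto _).comp hlim) ?_
    refine (hyφ.smul hlim).congr fun n => ?_
    simp only [Function.comp_apply]
    rw [hx]
  have hsymm : (A : E →ₗ[ℂ] E).IsSymmetric :=
    ContinuousLinearMap.isSelfAdjoint_iff_isSymmetric.1 hA
  have horth : ∀ n, inner ℂ w (x n) = 0 := by
    intro n
    have h1 := hsymm.orthogonalFamily_eigenspaces (i := z) (j := y n) (Ne.symm (hyne n))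
      ⟨w, Module.End.mem_eigenspace_iff.2 hwA⟩ ⟨x n, Module.End.mem_eigenspace_iff.2 (hx n)⟩
    simpa using h1
  have h0 : inner ℂ w w = 0 :=
    tendsto_nhds_unique ((innerSL ℂ w).continuous.tendsto _ |>.comp hlim)
      (by simp [Function.comp_def, horth])
  rw [inner_self_eq_zero] at h0
  simp [h0] at hw1

/-- A point of the spectrum where a self-adjoint operator is a compact perturbation of an
invertible one belongs to the discrete spectrum. -/
theorem mem_discSpectrum_of_eq_add {A U K : E →L[ℂ] E} (hA : IsSelfAdjoint A) {z : ℂ}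
    (hz : z ∈ spectrum ℂ A) (hU : IsUnit U) (hK : IsCompactOperator K)
    (h : A - z • 1 = U + K) : z ∈ discSpectrum A := by
  refine ⟨hz, not_accPt_spectrum_of_eq_add hA hU hK h, ?_,
    finiteDimensional_eigenspace_of_eq_add hU hK h⟩
  rw [mem_spectrum_iff_not_isUnit_sub, h] at hz
  obtain ⟨x, hx0, hx⟩ := exists_ne_zero_of_not_isUnit_add hU hK hz
  refine Module.End.hasEigenvalue_of_hasEigenvector (x := x)
    ⟨Module.End.mem_eigenspace_iff.2 ?_, hx0⟩
  have := congrArg (fun R : E →L[ℂ] E => R x) h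
  have h2 : A x - z • x = U x + K x := by simpa using this
  rw [hx] at h2
  exact sub_eq_zero.1 h2

end SelfAdjoint

/-! ### Schur complements -/

/-- Elimination of unknowns in the abstract: `π` keeps some unknowns, `ρ` is the reduced right-hand
side and `σ` recovers the eliminated ones. Unique solvability then passes both ways; every Schur
complement below is an instance. -/
theorem bijective_iff_of_reduction {α β α' β' : Type*} {T : α → β} {S : α' → β'} (π : α → α')
    (ρ : β → β') (σ : α' → β → α) (hρ : Function.Surjective ρ) (hσ : ∀ x b, π (σ x b) = x)
    (h : ∀ a b, T a = b ↔ S (π a) = ρ b ∧ a = σ (π a) b) :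
    Function.Bijective T ↔ Function.Bijective S := by
  rw [Function.bijective_iff_existsUnique, Function.bijective_iff_existsUnique]
  constructor
  · intro hT f
    obtain ⟨b, rfl⟩ := hρ f
    obtain ⟨a, ha, hu⟩ := hT b
    refine ⟨π a, ((h a b).1 ha).1, fun x hx => ?_⟩
    have hx' : T (σ x b) = b := (h _ _).2 (by simpa only [hσ, and_true] using hx)
    rw [← hu _ hx', hσ]
  · intro hS b
    obtain ⟨x, hx, hu⟩ := hS (ρ b)
    refine ⟨σ x b, (h _ _).2 (by simpa only [hσ, and_true] using hx), fun a ha => ?_⟩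
    obtain ⟨h1, h2⟩ := (h a b).1 ha
    rw [h2, hu _ h1]

/-! ### Coordinates in a direct sum -/

theorem toLp_fst_snd {E F : Type*} (x : HSum E F) :
    (WithLp.toLp 2 (x.fst, x.snd) : HSum E F) = x := rfl

theorem hsum_eq_iff {E F : Type*} {x y : HSum E F} : x = y ↔ x.fst = y.fst ∧ x.snd = y.snd := by
  refine ⟨by rintro rfl; simp, fun h => ?_⟩
  apply WithLp.ofLp_injective 2
  exact Prod.ext h.1 h.2

theorem norm_fst_le {E F : Type*} [NormedAddCommGroup E] [NormedAddCommGroup F]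
    (x : HSum E F) : ‖x.fst‖ ≤ ‖x‖ := by
  rw [WithLp.prod_norm_eq_of_L2]
  exact Real.le_sqrt_of_sq_le (by nlinarith [sq_nonneg ‖x.snd‖])

theorem norm_le_norm_toLp {E F E' F' : Type*} [NormedAddCommGroup E] [NormedAddCommGroup F]
    [NormedAddCommGroup E'] [NormedAddCommGroup F'] {x : E} {x' : E'} {y : F} {y' : F'}
    (hx : ‖x‖ ≤ ‖x'‖) (hy : ‖y‖ ≤ ‖y'‖) :
    ‖(WithLp.toLp 2 (x, y) : HSum E F)‖ ≤ ‖(WithLp.toLp 2 (x', y') : HSum E' F')‖ := by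
  rw [WithLp.prod_norm_eq_of_L2, WithLp.prod_norm_eq_of_L2]
  apply Real.sqrt_le_sqrt
  simp only [WithLp.toLp_fst, WithLp.toLp_snd]
  gcongr

section Schur

variable {E F G : Type*} [NormedAddCommGroup E] [NormedSpace ℂ E]
  [NormedAddCommGroup F] [NormedSpace ℂ F] [NormedAddCommGroup G] [NormedSpace ℂ G]

/-- The inclusion of the first summand. -/
noncomputable def inlL (E F : Type*) [NormedAddCommGroup E] [NormedSpace ℂ E]
    [NormedAddCommGroup F] [NormedSpace ℂ F] : E →L[ℂ] HSum E F :=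
  (WithLp.prodContinuousLinearEquiv 2 ℂ E F).symm.toContinuousLinearMap ∘L
    ContinuousLinearMap.inl ℂ E F

/-- The inclusion of the second summand. -/
noncomputable def inrL (E F : Type*) [NormedAddCommGroup E] [NormedSpace ℂ E]
    [NormedAddCommGroup F] [NormedSpace ℂ F] : F →L[ℂ] HSum E F :=
  (WithLp.prodContinuousLinearEquiv 2 ℂ E F).symm.toContinuousLinearMap ∘L
    ContinuousLinearMap.inr ℂ E F

@[simp] theorem inlL_apply (x : E) : inlL E F x = WithLp.toLp 2 (x, 0) := rfl

@[simp] theorem inrL_apply (y : F) : inrL E F y = WithLp.toLp 2 (0, y) := rfl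

theorem block₂_apply (A : E →L[ℂ] E) (B : F →L[ℂ] E) (C : E →L[ℂ] F) (D : F →L[ℂ] F)
    (x : HSum E F) :
    block₂ A B C D x = WithLp.toLp 2 (A x.fst + B x.snd, C x.fst + D x.snd) := rfl

theorem block₃_apply (A : E →L[ℂ] E) (B : F →L[ℂ] E) (C : E →L[ℂ] F) (D : F →L[ℂ] F)
    (B' : G →L[ℂ] F) (C' : F →L[ℂ] G) (D' : G →L[ℂ] G) (x : HSum E (HSum F G)) :
    block₃ A B C D B' C' D' x = WithLp.toLp 2 (A x.fst + B x.snd.fst,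
      WithLp.toLp 2 (C x.fst + (D x.snd.fst + B' x.snd.snd),
        C' x.snd.fst + D' x.snd.snd)) := by
  change WithLp.toLp 2 (A x.fst + B x.snd.fst,
      WithLp.toLp 2 (C x.fst, 0) + WithLp.toLp 2 (D x.snd.fst + B' x.snd.snd,
        C' x.snd.fst + D' x.snd.snd)) = _
  rw [← WithLp.toLp_add, Prod.mk_add_mk, zero_add]

theorem block₂_sub_smul_one (A : E →L[ℂ] E) (B : F →L[ℂ] E) (C : E →L[ℂ] F) (D : F →L[ℂ] F)
    (z : ℂ) : block₂ A B C D - z • 1 = block₂ (A - z • 1) B C (D - z • 1) := by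
  ext x
  rw [hsum_eq_iff]
  simp only [WithLp.toLp_fst, WithLp.toLp_snd, block₂_apply, _root_.sub_apply, _root_.smul_apply,
    one_apply_eq_self, WithLp.sub_fst, WithLp.sub_snd, WithLp.smul_fst,
    WithLp.smul_snd]
  constructor <;> abel

theorem block₃_sub_smul_one (A : E →L[ℂ] E) (B : F →L[ℂ] E) (C : E →L[ℂ] F) (D : F →L[ℂ] F)
    (B' : G →L[ℂ] F) (C' : F →L[ℂ] G) (D' : G →L[ℂ] G) (z : ℂ) :
    block₃ A B C D B' C' D' - z • 1 =
      block₃ (A - z • 1) B C (D - z • 1) B' C' (D' - z • 1) := by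
  rw [block₃, block₂_sub_smul_one, block₂_sub_smul_one]
  rfl

/-! ### Invertibility -/

theorem isUnit_block₂_iff [CompleteSpace E] [CompleteSpace F] (A : E →L[ℂ] E) (B : F →L[ℂ] E)
    (C : E →L[ℂ] F) {D R : F →L[ℂ] F} (hDR : ∀ y, D (R y) = y) (hRD : ∀ y, R (D y) = y) :
    IsUnit (block₂ A B C D) ↔ IsUnit (A - B ∘L R ∘L C) := by
  rw [ContinuousLinearMap.isUnit_iff_bijective, ContinuousLinearMap.isUnit_iff_bijective]
  refine bijective_iff_of_reduction (fun x => x.fst) (fun b => b.fst - B (R b.snd))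
    (fun x b => WithLp.toLp 2 (x, R (b.snd - C x)))
    (fun f => ⟨WithLp.toLp 2 (f, 0), by simp⟩) (fun _ _ => rfl) fun a b => ?_
  rw [hsum_eq_iff, hsum_eq_iff]
  simp only [WithLp.toLp_fst, WithLp.toLp_snd, block₂_apply, _root_.sub_apply,
    ContinuousLinearMap.comp_apply,
    map_sub, true_and]
  constructor
  · rintro ⟨h1, h2⟩
    have h3 : a.snd = R b.snd - R (C a.fst) := by rw [← h2, map_add, hRD]; abel
    refine ⟨?_, h3⟩
    rw [← h1, h3, map_sub]
    abel
  · rintro ⟨h1, h3⟩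
    rw [h3, map_sub, map_sub, hDR, hDR]
    refine ⟨?_, by abel⟩
    rw [sub_eq_iff_eq_add] at h1
    rw [← sub_eq_zero, ← sub_eq_zero.2 h1]
    abel

theorem isUnit_block₃_iff [CompleteSpace E] [CompleteSpace F] [CompleteSpace G]
    (A : E →L[ℂ] E) (B : F →L[ℂ] E) (C : E →L[ℂ] F) (D : F →L[ℂ] F) (B' : G →L[ℂ] F)
    (C' : F →L[ℂ] G) {D' R : G →L[ℂ] G} (hDR : ∀ y, D' (R y) = y) (hRD : ∀ y, R (D' y) = y) :
    IsUnit (block₃ A B C D B' C' D') ↔ IsUnit (block₂ A B C (D - B' ∘L R ∘L C')) := by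
  rw [ContinuousLinearMap.isUnit_iff_bijective, ContinuousLinearMap.isUnit_iff_bijective]
  refine bijective_iff_of_reduction (fun x => WithLp.toLp 2 (x.fst, x.snd.fst))
    (fun b => WithLp.toLp 2 (b.fst, b.snd.fst - B' (R b.snd.snd)))
    (fun x b => WithLp.toLp 2 (x.fst, WithLp.toLp 2 (x.snd, R (b.snd.snd - C' x.snd))))
    (fun f => ⟨WithLp.toLp 2 (f.fst, WithLp.toLp 2 (f.snd, 0)), by simp [toLp_fst_snd]⟩)
    (fun _ _ => rfl) fun a b => ?_
  simp only [hsum_eq_iff]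
  simp only [WithLp.toLp_fst, WithLp.toLp_snd, block₂_apply, block₃_apply,
    _root_.sub_apply,
    ContinuousLinearMap.comp_apply, map_sub, true_and]
  constructor
  · rintro ⟨h1, h2, h3⟩
    have h4 : a.snd.snd = R b.snd.snd - R (C' a.snd.fst) := by rw [← h3, map_add, hRD]; abel
    refine ⟨⟨h1, ?_⟩, h4⟩
    rw [← h2, h4, map_sub]
    abel
  · rintro ⟨⟨h1, h2⟩, h4⟩
    refine ⟨h1, ?_, ?_⟩
    · rw [h4, map_sub]
      rw [← sub_eq_zero] at h2 ⊢
      rw [← h2]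
      abel
    · rw [h4, map_sub, hDR, hDR]
      abel

/-- Both operators are Schur complements of one matrix with diagonal `M`, `1` and off-diagonal `c`,
`a`, written with its two components in either order. -/
theorem isUnit_sub_comp_iff [CompleteSpace E] [CompleteSpace F] {M R : F →L[ℂ] F}
    (hMR : ∀ y, M (R y) = y) (hRM : ∀ y, R (M y) = y) (c : E →L[ℂ] F) (a : F →L[ℂ] E) :
    IsUnit (M - c ∘L a) ↔ IsUnit (1 - a ∘L R ∘L c) := by
  have h1 : ∀ y : E, (1 : E →L[ℂ] E) ((1 : E →L[ℂ] E) y) = y := fun _ => rfl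
  have e1 := isUnit_block₂_iff M c a (D := (1 : E →L[ℂ] E)) h1 h1
  have e2 := isUnit_block₂_iff (1 : E →L[ℂ] E) a c hMR hRM
  rw [ContinuousLinearMap.isUnit_iff_bijective] at e1 e2
  rw [show c ∘L (1 : E →L[ℂ] E) ∘L a = c ∘L a from rfl] at e1
  rw [← e1, ← e2]
  refine bijective_iff_of_reduction (fun x => WithLp.toLp 2 (x.snd, x.fst))
    (fun x => WithLp.toLp 2 (x.snd, x.fst)) (fun x _ => WithLp.toLp 2 (x.snd, x.fst))
    (fun x => ⟨WithLp.toLp 2 (x.snd, x.fst), rfl⟩) (fun _ _ => rfl) fun a b => ?_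
  simp only [hsum_eq_iff, WithLp.toLp_fst, WithLp.toLp_snd, block₂_apply,
    one_apply_eq_self, and_self, and_true]
  rw [and_comm, add_comm, add_comm (M a.fst)]

/-- Cramer's rule over commuting operators: the product with the adjugate matrix, in either order,
is the determinant times the identity. -/
theorem bijective_commuting_matrix_iff {α β β' γ : E →L[ℂ] E} (hαβ : α * β = β * α)
    (hαβ' : α * β' = β' * α) (hαγ : α * γ = γ * α) (hββ' : β * β' = β' * β)
    (hβγ : β * γ = γ * β) (hβ'γ : β' * γ = γ * β') :
    (Function.Bijective fun x : E × E => (α x.1 + β x.2, β' x.1 + γ x.2)) ↔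
      Function.Bijective (α * γ - β * β' : E →L[ℂ] E) := by
  have e : ∀ {S T : E →L[ℂ] E}, S * T = T * S → ∀ x, S (T x) = T (S x) :=
    fun h x => congrArg (fun R : E →L[ℂ] E => R x) h
  have hδ : ∀ x, (α * γ - β * β' : E →L[ℂ] E) x = α (γ x) - β (β' x) := fun _ => rfl
  constructor
  · rintro ⟨hi, hs⟩
    have hz : ∀ x u, α x + β u = 0 → β' x + γ u = 0 → x = 0 ∧ u = 0 := by
      intro x u h1 h2
      have := @hi (x, u) (0, 0) (by simp [h1, h2])
      simpa using this
    constructor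
    -- If the determinant kills `x`, both columns of the adjugate applied to `x` lie in the kernel
    -- of the matrix. Hence `α x = β' x = 0`, so `(x, 0)` is in the kernel as well.
    · rw [injective_iff_map_eq_zero]
      intro x hx
      rw [hδ] at hx
      obtain ⟨-, h2⟩ := hz (γ x) (-β' x) (by rw [map_neg, ← sub_eq_add_neg, hx])
        (by rw [map_neg, e hβ'γ]; abel)
      obtain ⟨-, h4⟩ := hz (-β x) (α x) (by rw [map_neg, e hαβ]; abel)
        (by rw [map_neg, ← e hββ', ← e hαγ, neg_add_eq_sub, hx])
      exact (hz x 0 (by rw [h4, map_zero, add_zero])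
        (by rw [neg_eq_zero.1 h2, map_zero, add_zero])).1
    · intro f
      -- Solving the system with right-hand side `(0, f)` shows that `α f` and `β f` are in the
      -- range of the determinant. Every vector has the form `α x + β u`, so the range is
      -- everything.
      have key : ∀ f, (∃ x, (α * γ - β * β' : E →L[ℂ] E) x = α f) ∧
          ∃ x, (α * γ - β * β' : E →L[ℂ] E) x = β f := by
        intro f
        obtain ⟨⟨x, u⟩, h⟩ := hs (0, f)
        simp only [Prod.mk.injEq] at h
        obtain ⟨h1, h2⟩ := h
        refine ⟨⟨u, ?_⟩, ⟨-x, ?_⟩⟩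
        · rw [hδ, ← h2, map_add, e hαβ', e hββ', eq_neg_of_add_eq_zero_left h1, map_neg]
          abel
        · rw [hδ, ← h2, map_neg, map_neg, map_neg, map_neg, map_add, e hβγ,
            eq_neg_of_add_eq_zero_right h1, map_neg, e hαγ]
          abel
      obtain ⟨⟨x, u⟩, h⟩ := hs (f, 0)
      simp only [Prod.mk.injEq] at h
      obtain ⟨y, hy⟩ := (key x).1
      obtain ⟨y', hy'⟩ := (key u).2
      exact ⟨y + y', by rw [map_add, hy, hy', h.1]⟩
  · rintro ⟨hi, hs⟩
    constructor
    · rintro ⟨x, u⟩ ⟨x', u'⟩ h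
      simp only [Prod.mk.injEq] at h
      obtain ⟨h1, h2⟩ := h
      have h1' : α (x - x') = - β (u - u') := by
        rw [map_sub, map_sub, neg_sub, sub_eq_sub_iff_add_eq_add, h1, add_comm]
      have h2' : γ (u - u') = - β' (x - x') := by
        rw [map_sub, map_sub, neg_sub, sub_eq_sub_iff_add_eq_add, add_comm, h2]
      have hx : x - x' = 0 := (injective_iff_map_eq_zero _).1 hi _ (by
        rw [hδ, e hαγ, h1', map_neg, ← e hβγ, h2', map_neg]; abel)
      have hu : u - u' = 0 := (injective_iff_map_eq_zero _).1 hi _ (by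
        rw [hδ, h2', map_neg, e hαβ', h1', map_neg, e hββ']; abel)
      rw [sub_eq_zero.1 hx, sub_eq_zero.1 hu]
    · rintro ⟨f, g⟩
      obtain ⟨s, rfl⟩ := hs f
      obtain ⟨t, rfl⟩ := hs g
      refine ⟨(γ s - β t, α t - β' s), ?_⟩
      simp only [map_sub, hδ, Prod.mk.injEq]
      refine ⟨?_, ?_⟩
      · rw [e hαβ t]; abel
      · rw [e hβ'γ s, e hαγ t, e hββ' t]; abel

/-- The perturbation is linearised by an extra unknown standing for `a' y`, giving the enlarged
system `T`. Eliminating the extra unknown returns the original block; eliminating `y` with `R`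
leaves a 2×2 matrix over `E` with commuting entries. -/
theorem isUnit_block₂_sub_comp_iff [CompleteSpace E] [CompleteSpace F] (A : E →L[ℂ] E)
    (a a' : F →L[ℂ] E) (c c' : E →L[ℂ] F) {M R : F →L[ℂ] F}
    (hMR : ∀ y, M (R y) = y) (hRM : ∀ y, R (M y) = y) {α β β' γ : E →L[ℂ] E}
    (hα : A - a ∘L R ∘L c = α) (hβ : a ∘L R ∘L c' = β) (hβ' : a' ∘L R ∘L c = β')
    (hγ : 1 - a' ∘L R ∘L c' = γ) (hαβ : α * β = β * α)
    (hαβ' : α * β' = β' * α) (hαγ : α * γ = γ * α) (hββ' : β * β' = β' * β)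
    (hβγ : β * γ = γ * β) (hβ'γ : β' * γ = γ * β') :
    IsUnit (block₂ A a c (M - c' ∘L a')) ↔ IsUnit (α * γ - β * β') := by
  rw [ContinuousLinearMap.isUnit_iff_bijective, ContinuousLinearMap.isUnit_iff_bijective,
    ← bijective_commuting_matrix_iff hαβ hαβ' hαγ hββ' hβγ hβ'γ]
  let T : (E × E) × F → (E × E) × F := fun x =>
    ((A x.1.1 + a x.2, x.1.2 - a' x.2), c x.1.1 + M x.2 - c' x.1.2)
  have e1 : Function.Bijective T ↔ Function.Bijective (block₂ A a c (M - c' ∘L a')) := by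
    refine bijective_iff_of_reduction (fun x => WithLp.toLp 2 (x.1.1, x.2))
      (fun b => WithLp.toLp 2 (b.1.1, b.2 + c' b.1.2))
      (fun x b => ((x.fst, b.1.2 + a' x.snd), x.snd))
      (fun f => ⟨((f.fst, 0), f.snd), by simp [toLp_fst_snd]⟩) (fun _ _ => rfl) fun x b => ?_
    simp only [T, hsum_eq_iff, WithLp.toLp_fst, WithLp.toLp_snd, block₂_apply, Prod.ext_iff,
      _root_.sub_apply,
      ContinuousLinearMap.comp_apply, and_true, true_and]
    constructor
    · rintro ⟨⟨h1, h2⟩, h3⟩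
      refine ⟨⟨h1, ?_⟩, by rw [← h2]; abel⟩
      rw [← h3, ← h2, map_sub]
      abel
    · rintro ⟨⟨h1, h2⟩, h3⟩
      refine ⟨⟨h1, by rw [h3]; abel⟩, ?_⟩
      rw [h3, map_add, ← sub_eq_zero, ← sub_eq_zero.2 h2]
      abel
  have e2 : Function.Bijective T ↔
      Function.Bijective fun x : E × E => (α x.1 + β x.2, β' x.1 + γ x.2) := by
    refine bijective_iff_of_reduction (fun x => x.1)
      (fun b => (b.1.1 - a (R b.2), b.1.2 + a' (R b.2)))
      (fun x b => (x, R (b.2 - c x.1 + c' x.2)))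
      (fun f => ⟨(f, 0), by simp⟩) (fun _ _ => rfl) fun x b => ?_
    subst hα hβ hβ' hγ
    simp only [T, Prod.ext_iff, _root_.sub_apply, one_apply_eq_self,
      ContinuousLinearMap.comp_apply, true_and]
    constructor
    · rintro ⟨⟨h1, h2⟩, h3⟩
      have h4 : x.2 = R (b.2 - c x.1.1 + c' x.1.2) := by
        rw [← h3, ← hRM x.2, hMR]
        congr 1
        abel
      refine ⟨⟨?_, ?_⟩, h4⟩
      · rw [← h1, show a x.2 = _ from congrArg a h4]
        simp only [map_add, map_sub]
        abel
      · rw [← h2, show a' x.2 = _ from congrArg a' h4]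
        simp only [map_add, map_sub]
        abel
    · rintro ⟨⟨h1, h2⟩, h4⟩
      refine ⟨⟨?_, ?_⟩, ?_⟩
      · rw [h4, ← sub_eq_zero, ← sub_eq_zero.2 h1]
        simp only [map_add, map_sub]
        abel
      · rw [h4, ← sub_eq_zero, ← sub_eq_zero.2 h2]
        simp only [map_add, map_sub]
        abel
      · rw [h4, hMR]
        abel
  rw [← e1, e2]

/-! ### Singularity -/

/-- The vectors `(x, -R C x)` make the second row vanish, and the first row becomes the Schur
complement applied to `x`. -/
theorem IsSingular.block₂_of_schur (A : E →L[ℂ] E) (B : F →L[ℂ] E) (C : E →L[ℂ] F)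
    {D R : F →L[ℂ] F} (hDR : ∀ y, D (R y) = y) (h : IsSingular (A - B ∘L R ∘L C)) :
    IsSingular (block₂ A B C D) := by
  refine IsSingular.of_comp_right (inlL E F - inrL E F ∘L R ∘L C) (fun x => ?_) ?_
  · refine (norm_fst_le ((inlL E F - inrL E F ∘L R ∘L C) x)).trans' (le_of_eq ?_)
    simp
  · convert h.comp_left (inlL E F) using 1
    ext x
    rw [hsum_eq_iff]
    simp [block₂_apply, hDR, sub_eq_add_neg]

theorem IsSingular.block₃_of_schur (A : E →L[ℂ] E) (B : F →L[ℂ] E) (C : E →L[ℂ] F)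
    (D : F →L[ℂ] F) (B' : G →L[ℂ] F) (C' : F →L[ℂ] G) {D' R : G →L[ℂ] G}
    (hDR : ∀ y, D' (R y) = y) (h : IsSingular (block₂ A B C (D - B' ∘L R ∘L C'))) :
    IsSingular (block₃ A B C D B' C' D') := by
  let J : HSum E F →L[ℂ] HSum E (HSum F G) :=
    inlL E (HSum F G) ∘L WithLp.fstL 2 ℂ E F +
      inrL E (HSum F G) ∘L (inlL F G - inrL F G ∘L R ∘L C') ∘L WithLp.sndL 2 ℂ E F
  have hJ : ∀ x, J x = WithLp.toLp 2 (x.fst, WithLp.toLp 2 (x.snd, -R (C' x.snd))) := by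
    intro x
    simp [J, hsum_eq_iff]
  refine IsSingular.of_comp_right J (fun x => ?_) ?_
  · rw [hJ]
    exact norm_le_norm_toLp (x := x.fst) (y := x.snd) le_rfl
      (norm_fst_le (E := F) (F := G) (WithLp.toLp 2 (x.snd, -R (C' x.snd))))
  · convert h.comp_left (inlL E (HSum F G) ∘L WithLp.fstL 2 ℂ E F +
      inrL E (HSum F G) ∘L inlL F G ∘L WithLp.sndL 2 ℂ E F) using 1
    ext x
    simp [hsum_eq_iff, block₂_apply, block₃_apply, hJ, hDR, sub_eq_add_neg]

theorem norm_inrL (y : F) : ‖inrL E F y‖ = ‖y‖ := by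
  rw [inrL_apply, WithLp.prod_norm_eq_of_L2]
  simp

theorem IsSingular.block₂_of_ker (A : E →L[ℂ] E) (B : F →L[ℂ] E) (C : E →L[ℂ] F)
    {D : F →L[ℂ] F} {V : Submodule ℂ F} (hV : V ≤ LinearMap.ker (B : F →ₗ[ℂ] E))
    (h : IsSingular (D ∘L V.subtypeL)) : IsSingular (block₂ A B C D) := by
  refine IsSingular.of_comp_right (inrL E F ∘L V.subtypeL) (fun x => ?_) ?_
  · simp only [ContinuousLinearMap.comp_apply, norm_inrL]
    exact le_rfl
  · convert h.comp_left (inrL E F) using 1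
    ext x
    have hx : B x = 0 := hV x.2
    simp [block₂_apply, hx]

theorem IsSingular.block₃_of_ker (A : E →L[ℂ] E) (B : F →L[ℂ] E) (C : E →L[ℂ] F)
    (D : F →L[ℂ] F) (B' : G →L[ℂ] F) (C' : F →L[ℂ] G) {D' : G →L[ℂ] G} {V : Submodule ℂ G}
    (hV : V ≤ LinearMap.ker (B' : G →ₗ[ℂ] F)) (h : IsSingular (D' ∘L V.subtypeL)) :
    IsSingular (block₃ A B C D B' C' D') := by
  refine IsSingular.of_comp_right (inrL E (HSum F G) ∘L inrL F G ∘L V.subtypeL) (fun x => ?_) ?_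
  · simp only [ContinuousLinearMap.comp_apply, norm_inrL]
    exact le_rfl
  · convert h.comp_left (inrL E (HSum F G) ∘L inrL F G) using 1
    ext x
    have hx : B' x = 0 := hV x.2
    simp [block₃_apply, hx]

/-- On vectors `(0, y)` the only term besides `D y` is `B y`, which factors through the
finite-dimensional `E` and so preserves singularity. -/
theorem IsSingular.block₂_of_finiteDimensional [FiniteDimensional ℂ E] (A : E →L[ℂ] E)
    (B : F →L[ℂ] E) (C : E →L[ℂ] F) {D : F →L[ℂ] F} (h : IsSingular D) :
    IsSingular (block₂ A B C D) := by
  refine IsSingular.of_comp_right (inrL E F) (fun x => (norm_inrL x).ge) ?_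
  convert (h.comp_left (inrL E F)).add_comp (inlL E F) B using 1
  ext x
  simp [hsum_eq_iff, block₂_apply]

/-! ### Compact perturbations -/

theorem block₂_add (A A' : E →L[ℂ] E) (B B' : F →L[ℂ] E) (C C' : E →L[ℂ] F)
    (D D' : F →L[ℂ] F) :
    block₂ (A + A') (B + B') (C + C') (D + D') = block₂ A B C D + block₂ A' B' C' D' := by
  ext x
  simp only [hsum_eq_iff, WithLp.toLp_fst, WithLp.toLp_snd, block₂_apply, _root_.add_apply,
    WithLp.add_fst,
    WithLp.add_snd]
  constructor <;> abel

theorem isCompactOperator_block₂ {A : E →L[ℂ] E} {B : F →L[ℂ] E} {C : E →L[ℂ] F}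
    {D : F →L[ℂ] F} (hA : IsCompactOperator A) (hB : IsCompactOperator B)
    (hC : IsCompactOperator C) (hD : IsCompactOperator D) :
    IsCompactOperator (block₂ A B C D) := by
  have h1 := (hA.comp_clm (WithLp.fstL 2 ℂ E F)).clm_comp (inlL E F)
  have h2 := (hB.comp_clm (WithLp.sndL 2 ℂ E F)).clm_comp (inlL E F)
  have h3 := (hC.comp_clm (WithLp.fstL 2 ℂ E F)).clm_comp (inrL E F)
  have h4 := (hD.comp_clm (WithLp.sndL 2 ℂ E F)).clm_comp (inrL E F)
  refine (congrArg IsCompactOperator (funext fun x => ?_)).mp ((h1.add h2).add (h3.add h4))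
  simp [hsum_eq_iff, block₂_apply]

theorem isCompactOperator_comp [FiniteDimensional ℂ G] (c : G →L[ℂ] F) (a : E →L[ℂ] G) :
    IsCompactOperator (c ∘L a) :=
  have : ProperSpace G := FiniteDimensional.proper ℂ G
  (isCompactOperator_of_locallyCompactSpace_rng c).comp_clm a

theorem block₂_sub_comp_eq_add {H : Type*} [NormedAddCommGroup H] [NormedSpace ℂ H]
    (A : E →L[ℂ] E) (B : F →L[ℂ] E) (C : E →L[ℂ] F) (D : F →L[ℂ] F)
    (c : H →L[ℂ] E) (a : E →L[ℂ] H) (z : ℂ) :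
    block₂ (A - c ∘L a) B C D - z • 1 =
      (block₂ A B C D - z • 1) + block₂ (-(c ∘L a)) 0 0 0 := by
  rw [block₂_sub_smul_one, block₂_sub_smul_one, ← block₂_add]
  simp [sub_eq_add_neg, add_right_comm]

theorem isCompactOperator_block₂_neg_comp {H : Type*} [NormedAddCommGroup H] [NormedSpace ℂ H]
    [FiniteDimensional ℂ H] (c : H →L[ℂ] E) (a : E →L[ℂ] H) :
    IsCompactOperator (block₂ (-(c ∘L a)) 0 0 0 : HSum E F →L[ℂ] HSum E F) :=
  isCompactOperator_block₂ (isCompactOperator_comp c a).neg isCompactOperator_zero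
    isCompactOperator_zero isCompactOperator_zero

end Schur

/-! ### Self-adjoint operator matrices -/

section SelfAdjointBlocks

variable {E F : Type*} [NormedAddCommGroup E] [InnerProductSpace ℂ E] [CompleteSpace E]
  [NormedAddCommGroup F] [InnerProductSpace ℂ F] [CompleteSpace F]

theorem isSelfAdjoint_block₂ {A : E →L[ℂ] E} {B : F →L[ℂ] E} {C : E →L[ℂ] F} {D : F →L[ℂ] F}
    (hA : IsSelfAdjoint A) (hD : IsSelfAdjoint D)
    (hBC : ∀ x y, inner ℂ (B y) x = inner ℂ y (C x)) : IsSelfAdjoint (block₂ A B C D) := by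
  rw [ContinuousLinearMap.isSelfAdjoint_iff_isSymmetric] at *
  intro x y
  have h1 : inner ℂ (A x.fst) y.fst = inner ℂ x.fst (A y.fst) := hA _ _
  have h2 : inner ℂ (D x.snd) y.snd = inner ℂ x.snd (D y.snd) := hD _ _
  have h3 : inner ℂ (C x.fst) y.snd = inner ℂ x.fst (B y.snd) := by
    rw [← inner_conj_symm, ← hBC, inner_conj_symm]
  simp only [ContinuousLinearMap.coe_coe, WithLp.prod_inner_apply, block₂_apply, inner_add_left,
    inner_add_right]
  have e1 : ∀ u : HSum E F, u.ofLp.1 = u.fst := fun _ => rfl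
  have e2 : ∀ u : HSum E F, u.ofLp.2 = u.snd := fun _ => rfl
  simp only [e1, e2, h1, h2, h3, hBC]
  ring

theorem isSelfAdjoint_block₃ {G : Type*} [NormedAddCommGroup G] [InnerProductSpace ℂ G]
    [CompleteSpace G] {A : E →L[ℂ] E} {B : F →L[ℂ] E} {C : E →L[ℂ] F} {D : F →L[ℂ] F}
    {B' : G →L[ℂ] F} {C' : F →L[ℂ] G} {D' : G →L[ℂ] G}
    (hA : IsSelfAdjoint A) (hD : IsSelfAdjoint D) (hD' : IsSelfAdjoint D')
    (hBC : ∀ x y, inner ℂ (B y) x = inner ℂ y (C x))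
    (hBC' : ∀ x y, inner ℂ (B' y) x = inner ℂ y (C' x)) :
    IsSelfAdjoint (block₃ A B C D B' C' D') := by
  refine isSelfAdjoint_block₂ hA (isSelfAdjoint_block₂ hD hD' hBC') fun x y => ?_
  change inner ℂ (B y.fst) x = inner ℂ y (WithLp.toLp 2 (C x, 0))
  rw [WithLp.prod_inner_apply, hBC]
  simp

/-- Bordering by a finite-dimensional space and compact perturbations only create discrete
spectrum. -/
theorem mem_discSpectrum_block₂ [FiniteDimensional ℂ E] {A : E →L[ℂ] E} {B : F →L[ℂ] E}
    {C : E →L[ℂ] F} {D U K : F →L[ℂ] F} (hT : IsSelfAdjoint (block₂ A B C D)) {z : ℂ}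
    (hz : z ∈ spectrum ℂ (block₂ A B C D)) (hU : IsUnit U) (hK : IsCompactOperator K)
    (hD : D - z • 1 = U + K) : z ∈ discSpectrum (block₂ A B C D) := by
  have : ProperSpace E := FiniteDimensional.proper ℂ E
  -- Every entry entering or leaving the finite-dimensional `E` is compact, so the corner may be
  -- traded for `1`.
  refine mem_discSpectrum_of_eq_add hT hz (U := block₂ 1 0 0 U)
    (K := block₂ (A - z • 1 - 1) B C K) ?_ ?_ ?_
  · obtain ⟨u, rfl⟩ := hU
    rw [isUnit_block₂_iff 1 0 0 (units_apply_inv_apply u) (units_inv_apply_apply u)]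
    simp
  · exact isCompactOperator_block₂
      (isCompactOperator_of_locallyCompactSpace_rng _)
      (isCompactOperator_of_locallyCompactSpace_dom _)
      (isCompactOperator_of_locallyCompactSpace_rng _) hK
  · rw [← block₂_add, block₂_sub_smul_one, hD]
    simp

end SelfAdjointBlocks

/-! ### Bump functions satisfying finitely many linear conditions -/

section Bumps

variable {X : Type*} [TopologicalSpace X] [NormalSpace X] [T1Space X] [∀ x : X, (𝓝[≠] x).NeBot]

/-- Real continuous functions supported in a nonempty open set of a space without isolated points
cannot be separated by finitely many linear conditions. -/
theorem exists_continuousMap_ne_zero_of_finiteDimensional {S : Set X} (hS : IsOpen S)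
    {x₀ : X} (hx₀ : x₀ ∈ S) {W : Type*} [AddCommGroup W] [Module ℝ W] [FiniteDimensional ℝ W]
    (l : C(X, ℝ) →ₗ[ℝ] W) : ∃ b : C(X, ℝ), b ≠ 0 ∧ (∀ x ∉ S, b x = 0) ∧ l b = 0 := by
  classical
  -- One point more than the dimension of `W`: bumps equal to `1` at one point of `t` and `0` at the
  -- others are independent, and some nontrivial combination of them is killed by `l`.
  obtain ⟨t, htS, htc⟩ :=
    (infinite_of_mem_nhds x₀ (hS.mem_nhds hx₀)).exists_subset_card_eq (Module.finrank ℝ W + 1)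
  have hb : ∀ i : t, ∃ b : C(X, ℝ), (∀ x ∉ S, b x = 0) ∧ (∀ j : t, j ≠ i → b j = 0) ∧
      b i = 1 := by
    intro i
    have hfin : IsClosed ((t.erase i : Finset X) : Set X) := (Finset.finite_toSet _).isClosed
    obtain ⟨b, hb0, hb1, -⟩ := exists_continuous_zero_one_of_isClosed
      (hS.isClosed_compl.union hfin) (isClosed_singleton (x := (i : X))) (by
        rw [Set.disjoint_singleton_right]
        rintro (h | h)
        · exact h (htS i.2)
        · simp at h)
    refine ⟨b, fun x hx => hb0 (Or.inl hx), fun j hj => hb0 (Or.inr ?_), hb1 rfl⟩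
    simpa using fun h => hj (Subtype.ext h)
  choose b hbS hb0 hb1 using hb
  let L : (t → ℝ) →ₗ[ℝ] C(X, ℝ) := Fintype.linearCombination ℝ b
  have hL : ∀ c x, L c x = ∑ i, c i * b i x := by
    intro c x
    simp [L, Fintype.linearCombination_apply]
  have hker : LinearMap.ker (l ∘ₗ L) ≠ ⊥ := LinearMap.ker_ne_bot_of_finrank_lt (by simp [htc])
  obtain ⟨c, hc, hc0⟩ := Submodule.exists_mem_ne_zero_of_ne_bot hker
  refine ⟨L c, fun h0 => hc0 (funext fun i => ?_), fun x hx => ?_, hc⟩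
  · have h1 := hL c i
    rw [h0, Finset.sum_eq_single i (fun j _ hj => by rw [hb0 j i (Ne.symm hj), mul_zero])
      (by simp), hb1, mul_one] at h1
    exact h1.symm
  · rw [hL]
    exact Finset.sum_eq_zero fun i _ => by rw [hbS i x hx, mul_zero]

end Bumps

/-! ### Multiplication by complex continuous functions -/

section Multiplication

set_option linter.unusedSectionVars false

variable {X Y : Type*}
  [TopologicalSpace X] [T2Space X] [CompactSpace X] [SecondCountableTopology X]
  [MeasureSpace X] [BorelSpace X] [IsFiniteMeasure (volume : Measure X)]
  [TopologicalSpace Y] [T2Space Y] [CompactSpace Y] [SecondCountableTopology Y]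
  [MeasureSpace Y] [BorelSpace Y] [IsFiniteMeasure (volume : Measure Y)]

theorem coeFn_mulOp (w : C(X, ℝ)) (f : L2 X) : mulOp w f =ᵐ[volume] fun x => (w x : ℂ) * f x :=
  (memLp_mul w f).coeFn_toLp

theorem coeFn_create (v : C(Y, ℝ)) (f : L2 X) :
    create v f =ᵐ[volume] fun z : X × Y => (v z.2 : ℂ) * f z.1 :=
  (memLp_create v f).coeFn_toLp

theorem coeFn_annih (v : C(Y, ℝ)) (f : L2 (X × Y)) :
    annih v f =ᵐ[volume] fun x => ∫ s, (v s : ℂ) * f (x, s) :=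
  (memLp_annih v f).coeFn_toLp

theorem coeFn_create₀ (v : C(Y, ℝ)) (c : ℂ) :
    create₀ v c =ᵐ[volume] fun y => (v y : ℂ) * c := by
  change (c • (memLp_coeff v).toLp (fun y => (v y : ℂ)) : L2 Y) =ᵐ[volume] _
  filter_upwards [Lp.coeFn_smul c ((memLp_coeff v).toLp (fun y => (v y : ℂ))),
    (memLp_coeff v).coeFn_toLp] with y h1 h2
  rw [h1, Pi.smul_apply, h2, smul_eq_mul, mul_comm]

theorem annih₀_apply (v : C(Y, ℝ)) (f : L2 Y) : annih₀ v f = ∫ s, (v s : ℂ) * f s := rfl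

theorem coeFn_swapOp (f : L2 (X × Y)) : swapOp f =ᵐ[volume] fun z : Y × X => f z.swap :=
  Lp.coeFn_compMeasurePreserving f Measure.measurePreserving_swap

/-- Multiplication by a complex continuous function. -/
noncomputable def mulC (φ : C(X, ℂ)) : L2 X →L[ℂ] L2 X :=
  mulOp ⟨fun x => (φ x).re, by fun_prop⟩ + Complex.I • mulOp ⟨fun x => (φ x).im, by fun_prop⟩

theorem coeFn_mulC (φ : C(X, ℂ)) (f : L2 X) : mulC φ f =ᵐ[volume] fun x => φ x * f x := by
  change (mulOp ⟨fun x => (φ x).re, by fun_prop⟩ f +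
    Complex.I • mulOp ⟨fun x => (φ x).im, by fun_prop⟩ f : L2 X) =ᵐ[volume] _
  filter_upwards [Lp.coeFn_add (mulOp ⟨fun x => (φ x).re, by fun_prop⟩ f)
      (Complex.I • mulOp ⟨fun x => (φ x).im, by fun_prop⟩ f),
    Lp.coeFn_smul Complex.I (mulOp ⟨fun x => (φ x).im, by fun_prop⟩ f),
    coeFn_mulOp ⟨fun x => (φ x).re, by fun_prop⟩ f,
    coeFn_mulOp ⟨fun x => (φ x).im, by fun_prop⟩ f] with x h1 h2 h3 h4
  rw [h1, Pi.add_apply, h2, Pi.smul_apply, h3, h4]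
  simp only [ContinuousMap.coe_mk, smul_eq_mul]
  nth_rewrite 3 [← Complex.re_add_im (φ x)]
  ring

theorem mulOp_sub_smul_one (w : C(X, ℝ)) (z : ℂ) :
    mulOp w - z • 1 = mulC ⟨fun x => (w x : ℂ) - z, by fun_prop⟩ := by
  ext f : 1
  refine Lp.ext ?_
  change ((mulOp w f - z • f : L2 X) : X → ℂ) =ᵐ[volume] _
  filter_upwards [Lp.coeFn_sub (mulOp w f) (z • f), Lp.coeFn_smul z f, coeFn_mulOp w f,
    coeFn_mulC ⟨fun x => (w x : ℂ) - z, by fun_prop⟩ f] with x h1 h2 h3 h4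
  rw [h1, h4, Pi.sub_apply, h2, h3, Pi.smul_apply, smul_eq_mul]
  exact (sub_mul _ _ _).symm

theorem mulC_sub (φ ψ : C(X, ℂ)) : mulC (φ - ψ) = mulC φ - mulC ψ := by
  ext f : 1
  refine Lp.ext ?_
  change _ =ᵐ[volume] ((mulC φ f - mulC ψ f : L2 X) : X → ℂ)
  filter_upwards [Lp.coeFn_sub (mulC φ f) (mulC ψ f), coeFn_mulC φ f, coeFn_mulC ψ f,
    coeFn_mulC (φ - ψ) f] with x h1 h2 h3 h4
  rw [h1, h4, Pi.sub_apply, h2, h3, ContinuousMap.sub_apply, sub_mul]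

theorem mulC_mul (φ ψ : C(X, ℂ)) : mulC (φ * ψ) = mulC φ * mulC ψ := by
  ext f : 1
  refine Lp.ext ?_
  change _ =ᵐ[volume] ((mulC φ (mulC ψ f) : L2 X) : X → ℂ)
  filter_upwards [coeFn_mulC φ (mulC ψ f), coeFn_mulC ψ f,
    coeFn_mulC (φ * ψ) f] with x h1 h2 h3
  rw [h1, h3, h2, ContinuousMap.mul_apply, mul_assoc]

theorem mulC_one : mulC (1 : C(X, ℂ)) = 1 := by
  ext f : 1
  refine Lp.ext ?_
  filter_upwards [coeFn_mulC 1 f] with x h1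
  rw [h1, ContinuousMap.one_apply, one_mul]
  rfl

/-- The pointwise inverse of a continuous function without zeros. -/
noncomputable def invC (φ : C(X, ℂ)) (h : ∀ x, φ x ≠ 0) : C(X, ℂ) :=
  ⟨fun x => (φ x)⁻¹, φ.continuous.inv₀ h⟩

theorem mulC_invC_apply {φ : C(X, ℂ)} (h : ∀ x, φ x ≠ 0) (f : L2 X) :
    mulC φ (mulC (invC φ h) f) = f := by
  have : φ * invC φ h = 1 := by ext x; exact mul_inv_cancel₀ (h x)
  have h2 := mulC_mul φ (invC φ h)
  rw [this, mulC_one] at h2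
  exact (congrArg (fun R : L2 X →L[ℂ] L2 X => R f) h2).symm

theorem invC_mulC_apply {φ : C(X, ℂ)} (h : ∀ x, φ x ≠ 0) (f : L2 X) :
    mulC (invC φ h) (mulC φ f) = f := by
  have : invC φ h * φ = 1 := by ext x; exact inv_mul_cancel₀ (h x)
  have h2 := mulC_mul (invC φ h) φ
  rw [this, mulC_one] at h2
  exact (congrArg (fun R : L2 X →L[ℂ] L2 X => R f) h2).symm

theorem isUnit_mulC {φ : C(X, ℂ)} (h : ∀ x, φ x ≠ 0) : IsUnit (mulC φ) := by
  rw [ContinuousLinearMap.isUnit_iff_bijective]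
  exact Function.bijective_iff_has_inverse.2
    ⟨_, invC_mulC_apply h, mulC_invC_apply h⟩

/-- The fibre integral `x ↦ ∫ v(s) u(s) φ(x, s) ds`. -/
noncomputable def fiberInt (v u : C(Y, ℝ)) (φ : C(X × Y, ℂ)) : C(X, ℂ) :=
  ⟨fun x => ∫ s, (v s : ℂ) * (u s : ℂ) * φ (x, s), by
    have h := continuous_parametric_integral_of_continuous (μ := (volume : Measure Y))
      (f := fun (x : X) (s : Y) => (v s : ℂ) * (u s : ℂ) * φ (x, s))
      (by fun_prop) (isCompact_univ (X := Y))
    simpa using h⟩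

/-- The source of the integrals in the determinants: `f x` does not depend on `s` and factors out.
-/
theorem annih_mulC_create (v u : C(Y, ℝ)) (φ : C(X × Y, ℂ)) :
    annih v ∘L mulC φ ∘L create u = mulC (fiberInt v u φ) := by
  ext f : 1
  refine Lp.ext ?_
  change (annih v (mulC φ (create u f)) : X → ℂ) =ᵐ[volume] _
  filter_upwards [coeFn_annih v (mulC φ (create u f)), coeFn_mulC (fiberInt v u φ) f,
    ae_slice (coeFn_mulC φ (create u f)), ae_slice (coeFn_create u f)] with x h1 h2 h3 h4
  rw [h1, h2]
  refine Eq.trans ?_ (integral_mul_const (f x) _)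
  refine integral_congr_ae ?_
  filter_upwards [h3, h4] with s h5 h6
  rw [h5, h6]
  ring

theorem annih₀_mulC_create₀ (v u : C(Y, ℝ)) (φ : C(Y, ℂ)) :
    annih₀ v ∘L mulC φ ∘L create₀ u = (∫ s, (v s : ℂ) * (u s : ℂ) * φ s) • 1 := by
  ext
  change annih₀ v (mulC φ (create₀ u 1)) = (∫ s, (v s : ℂ) * (u s : ℂ) * φ s) • 1
  rw [annih₀_apply, smul_eq_mul, mul_one]
  refine integral_congr_ae ?_
  filter_upwards [coeFn_mulC φ (create₀ u 1), coeFn_create₀ u 1] with s h5 h6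
  rw [h5, h6]
  ring

theorem swapOp_swapOp (f : L2 (X × Y)) : swapOp (swapOp f) = f := by
  refine Lp.ext ?_
  filter_upwards [coeFn_swapOp (swapOp f),
    Measure.measurePreserving_swap.quasiMeasurePreserving.ae (coeFn_swapOp f)] with z h1 h2
  rw [h1, h2, Prod.swap_swap]

theorem swapOp_mulC (φ : C(X × Y, ℂ)) (f : L2 (X × Y)) :
    swapOp (mulC φ f) = mulC (φ.comp ⟨Prod.swap, continuous_swap⟩) (swapOp f) := by
  refine Lp.ext ?_
  filter_upwards [coeFn_swapOp (mulC φ f), coeFn_swapOp f,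
    Measure.measurePreserving_swap.quasiMeasurePreserving.ae (coeFn_mulC φ f),
    coeFn_mulC (φ.comp ⟨Prod.swap, continuous_swap⟩) (swapOp f)] with z h1 h2 h3 h4
  rw [h1, h3, h4, h2]
  rfl

/-! ### Symmetry -/

theorem isSelfAdjoint_mulOp (w : C(X, ℝ)) : IsSelfAdjoint (mulOp w) := by
  rw [ContinuousLinearMap.isSelfAdjoint_iff_isSymmetric]
  intro f g
  simp only [ContinuousLinearMap.coe_coe, L2.inner_def]
  refine integral_congr_ae ?_
  filter_upwards [coeFn_mulOp w f, coeFn_mulOp w g] with x h1 h2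
  rw [h1, h2]
  simp only [RCLike.inner_apply, map_mul, Complex.conj_ofReal]
  ring

theorem inner_annih₀ (v : C(Y, ℝ)) (c : ℂ) (f : L2 Y) :
    inner ℂ (annih₀ v f) c = inner ℂ f (create₀ v c) := by
  rw [L2.inner_def, annih₀_apply, RCLike.inner_apply, ← integral_conj, ← integral_const_mul]
  refine integral_congr_ae ?_
  filter_upwards [coeFn_create₀ v c] with y h1
  rw [h1]
  simp only [RCLike.inner_apply, map_mul, Complex.conj_ofReal]
  ring

theorem inner_annih (v : C(Y, ℝ)) (g : L2 X) (f : L2 (X × Y)) :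
    inner ℂ (annih v f) g = inner ℂ f (create v g) := by
  rw [L2.inner_def, L2.inner_def]
  have hint := L2.integrable_inner (𝕜 := ℂ) f (create v g)
  refine Eq.trans ?_ (integral_prod _ hint).symm
  refine integral_congr_ae ?_
  filter_upwards [coeFn_annih v f, ae_slice (coeFn_create v g)] with x h1 h2
  rw [h1, RCLike.inner_apply, ← integral_conj, ← integral_const_mul]
  refine integral_congr_ae ?_
  filter_upwards [h2] with y h3
  rw [h3]
  simp only [RCLike.inner_apply, map_mul, Complex.conj_ofReal]
  ring

theorem isSelfAdjoint_create₀_annih₀ (v : C(Y, ℝ)) :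
    IsSelfAdjoint (create₀ v ∘L annih₀ v) := by
  rw [ContinuousLinearMap.isSelfAdjoint_iff_isSymmetric]
  intro f g
  change inner ℂ (create₀ v (annih₀ v f)) g = inner ℂ f (create₀ v (annih₀ v g))
  rw [← inner_annih₀, ← inner_conj_symm, ← inner_annih₀, inner_conj_symm]

/-! ### Singular multiplication operators -/

/-- The inclusion of real continuous functions into `L₂`. -/
noncomputable def realToL2 : C(X, ℝ) →ₗ[ℝ] L2 X where
  toFun g := (memLp_coeff g).toLp (fun x => (g x : ℂ))
  map_add' g h := by
    rw [← MemLp.toLp_add]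
    exact MemLp.toLp_congr _ _ (Eventually.of_forall fun x => by simp)
  map_smul' c g := by
    rw [RingHom.id_apply, ← MemLp.toLp_const_smul]
    exact MemLp.toLp_congr _ _ (Eventually.of_forall fun x => by simp)

theorem coeFn_realToL2 (g : C(X, ℝ)) : realToL2 g =ᵐ[volume] fun x => (g x : ℂ) :=
  (memLp_coeff g).coeFn_toLp

variable [∀ x : X, (𝓝[≠] x).NeBot] [∀ y : Y, (𝓝[≠] y).NeBot]
  [(volume : Measure X).IsOpenPosMeasure] [(volume : Measure Y).IsOpenPosMeasure]

/-- Real continuous functions supported in a nonempty open set meet every subspace of finite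
codimension of `L₂`. -/
theorem exists_realToL2_mem_of_cofg {S : Set X} (hS : IsOpen S) {x₀ : X} (hx₀ : x₀ ∈ S)
    {N : Submodule ℂ (L2 X)} (hN : N.CoFG) :
    ∃ g : C(X, ℝ), g ≠ 0 ∧ (∀ x ∉ S, g x = 0) ∧ realToL2 g ∈ N := by
  have : FiniteDimensional ℂ (L2 X ⧸ N) := hN
  have : FiniteDimensional ℝ (L2 X ⧸ N) := Module.Finite.trans ℂ _
  obtain ⟨g, hg0, hgS, hg⟩ := exists_continuousMap_ne_zero_of_finiteDimensional hS hx₀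
    ((N.mkQ.restrictScalars ℝ) ∘ₗ realToL2)
  exact ⟨g, hg0, hgS, (Submodule.Quotient.mk_eq_zero N).1 hg⟩

theorem realToL2_ne_zero {g : C(X, ℝ)} (hg : g ≠ 0) : (realToL2 g : L2 X) ≠ 0 := by
  intro h
  have h1 : (fun x => (g x : ℂ)) =ᵐ[volume] fun _ => (0 : ℂ) := by
    filter_upwards [coeFn_realToL2 g, Lp.coeFn_zero ℂ 2 (volume : Measure X)] with x h2 h3
    rw [← h2, h, h3, Pi.zero_apply]
  have h2 := (Continuous.ae_eq_iff_eq volume (by fun_prop) continuous_const).1 h1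
  exact hg (ContinuousMap.ext fun x => Complex.ofReal_eq_zero.1 (congrFun h2 x))

/-- The test functions are supported where `‖φ‖ < ε`, a neighbourhood of the zero. -/
theorem isSingular_mulC {φ : C(X, ℂ)} {x₀ : X} (h : φ x₀ = 0) : IsSingular (mulC φ) := by
  intro ε hε N hN
  have hS : IsOpen {x | ‖φ x‖ < ε} := isOpen_lt (by fun_prop) continuous_const
  obtain ⟨g, hg0, hgS, hgN⟩ := exists_realToL2_mem_of_cofg hS (x₀ := x₀) (by simpa [h]) hN
  refine ⟨realToL2 g, hgN, realToL2_ne_zero hg0, Lp.norm_le_mul_norm_of_ae_le_mul ?_⟩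
  filter_upwards [coeFn_mulC φ (realToL2 g), coeFn_realToL2 g] with x h1 h2
  rw [h1, h2, norm_mul]
  by_cases hx : ‖φ x‖ < ε
  · gcongr
  · simp [hgS x hx]

theorem isUnit_mulC_iff {φ : C(X, ℂ)} : IsUnit (mulC φ) ↔ ∀ x, φ x ≠ 0 :=
  ⟨fun h _ hx => (isSingular_mulC hx).not_isUnit h, isUnit_mulC⟩

theorem create_ne_zero {b : C(Y, ℝ)} (hb : b ≠ 0) {g : C(X, ℝ)} (hg : g ≠ 0) :
    (create b (realToL2 g) : L2 (X × Y)) ≠ 0 := by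
  intro h
  have h1 : (fun z : X × Y => (b z.2 : ℂ) * (g z.1 : ℂ)) =ᵐ[volume] fun _ => (0 : ℂ) := by
    filter_upwards [coeFn_create b (realToL2 g), ae_fst (coeFn_realToL2 g),
      Lp.coeFn_zero ℂ 2 (volume : Measure (X × Y))] with z h2 h3 h4
    rw [← h3, ← h2, h, h4, Pi.zero_apply]
  rw [Measure.volume_eq_prod] at h1
  have h2 := (Continuous.ae_eq_iff_eq _ (by fun_prop) continuous_const).1 h1
  obtain ⟨y, hy⟩ := DFunLike.ne_iff.1 hb
  obtain ⟨x, hx⟩ := DFunLike.ne_iff.1 hg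
  have h3 := congrFun h2 (x, y)
  simp only [mul_eq_zero, Complex.ofReal_eq_zero] at h3
  exact h3.elim hy hx

theorem annih_create (v b : C(Y, ℝ)) (h : ∫ s, v s * b s = 0) (f : L2 X) :
    annih v (create b f) = 0 := by
  refine Lp.ext ?_
  filter_upwards [coeFn_annih v (create b f), ae_slice (coeFn_create b f),
    Lp.coeFn_zero ℂ 2 (volume : Measure X)] with x h1 h2 h3
  rw [h1, h3, Pi.zero_apply]
  have h4 : ∫ s, (v s : ℂ) * create b f (x, s) = ∫ s, ((v s * b s : ℝ) : ℂ) * f x := by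
    refine integral_congr_ae ?_
    filter_upwards [h2] with s h5
    rw [h5, Complex.ofReal_mul, mul_assoc]
  rw [h4, integral_mul_const, integral_complex_ofReal, h, Complex.ofReal_zero, zero_mul]

variable (X) in
/-- The functions annihilated by both `v` and `v'`. -/
noncomputable def annihKer (v v' : C(Y, ℝ)) : Submodule ℂ (L2 (X × Y)) :=
  LinearMap.ker ((annih v : L2 (X × Y) →L[ℂ] L2 X) : L2 (X × Y) →ₗ[ℂ] L2 X) ⊓
    LinearMap.ker ((annih v' : L2 (X × Y) →L[ℂ] L2 X) : L2 (X × Y) →ₗ[ℂ] L2 X)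

theorem create_mem_annihKer {v v' b : C(Y, ℝ)} (hv : ∫ s, v s * b s = 0)
    (hv' : ∫ s, v' s * b s = 0) (f : L2 X) : create b f ∈ annihKer X v v' :=
  ⟨LinearMap.mem_ker.2 (annih_create v b hv f), LinearMap.mem_ker.2 (annih_create v' b hv' f)⟩

/-- Integration against a fixed continuous function. -/
noncomputable def integralMulLin (u : C(Y, ℝ)) : C(Y, ℝ) →ₗ[ℝ] ℝ where
  toFun b := ∫ s, u s * b s
  map_add' b c := by
    have hint : ∀ b : C(Y, ℝ), Integrable (fun s => u s * b s) (volume : Measure Y) :=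
      fun b => Continuous.integrable_of_hasCompactSupport (by fun_prop)
        (HasCompactSupport.of_compactSpace _)
    rw [← integral_add (hint b) (hint c)]
    simp [mul_add]
  map_smul' r b := by
    rw [RingHom.id_apply, smul_eq_mul, ← integral_const_mul]
    simp [mul_left_comm]

theorem exists_continuousMap_integral_eq_zero {B : Set Y} (hB : IsOpen B) {y₀ : Y} (hy₀ : y₀ ∈ B)
    (v v' : C(Y, ℝ)) : ∃ b : C(Y, ℝ), b ≠ 0 ∧ (∀ y ∉ B, b y = 0) ∧
      ∫ s, v s * b s = 0 ∧ ∫ s, v' s * b s = 0 := by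
  obtain ⟨b, hb0, hbB, hb⟩ := exists_continuousMap_ne_zero_of_finiteDimensional hB hy₀
    ((integralMulLin v).prod (integralMulLin v'))
  exact ⟨b, hb0, hbB, congrArg Prod.fst hb, congrArg Prod.snd hb⟩

/-- A multiplication operator whose symbol has a zero stays singular on the functions annihilated
by two given annihilation operators. -/
theorem isSingular_mulC_ker {φ : C(X × Y, ℂ)} {z₀ : X × Y} (h : φ z₀ = 0) (v v' : C(Y, ℝ)) :
    IsSingular (mulC φ ∘L (annihKer X v v').subtypeL) := by
  refine IsSingular.comp_subtypeL_of_exists (E := L2 X) fun ε hε => ?_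
  have hS : IsOpen {x | ‖φ x‖ < ε} := isOpen_lt (by fun_prop) continuous_const
  obtain ⟨A, B, hA, hB, hzA, hzB, hAB⟩ := isOpen_prod_iff.1 hS z₀.1 z₀.2 (by simpa [h])
  obtain ⟨b, hb0, hbB, hbv, hbv'⟩ := exists_continuousMap_integral_eq_zero hB hzB v v'
  -- The test functions are products `g(x) b(y)`: the factor `b` secures membership in the kernel,
  -- while `g` remains free to satisfy the conditions defining `N`.
  refine ⟨create b, create_mem_annihKer hbv hbv', fun N hN => ?_⟩
  obtain ⟨g, hg0, hgA, hgN⟩ := exists_realToL2_mem_of_cofg hA hzA hN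
  refine ⟨realToL2 g, hgN, create_ne_zero hb0 hg0, Lp.norm_le_mul_norm_of_ae_le_mul ?_⟩
  filter_upwards [coeFn_mulC φ (create b (realToL2 g)), coeFn_create b (realToL2 g),
    ae_fst (coeFn_realToL2 g)] with z h1 h2 h3
  rw [h1, h2, h3, norm_mul]
  by_cases hz : z.1 ∈ A
  · by_cases hz' : z.2 ∈ B
    · gcongr
      exact (hAB (Set.mk_mem_prod hz hz')).le
    · simp [hbB _ hz']
  · simp [hgA _ hz]

end Multiplication

/-! ### Reduction to the Schur complement -/

section Reduction

set_option linter.unusedSectionVars false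

variable {X Y : Type*}
  [TopologicalSpace X] [T2Space X] [CompactSpace X] [SecondCountableTopology X]
  [MeasureSpace X] [BorelSpace X] [IsFiniteMeasure (volume : Measure X)]
  [TopologicalSpace Y] [T2Space Y] [CompactSpace Y] [SecondCountableTopology Y]
  [MeasureSpace Y] [BorelSpace Y] [IsFiniteMeasure (volume : Measure Y)]

/-- The function `w - z`. -/
noncomputable def shiftC (w : C(X, ℝ)) (z : ℂ) : C(X, ℂ) := ⟨fun x => (w x : ℂ) - z, by fun_prop⟩

theorem mulOp_sub_eq_mulC (w : C(X, ℝ)) (z : ℂ) : mulOp w - z • 1 = mulC (shiftC w z) :=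
  mulOp_sub_smul_one w z

/-- The symbol `w₂(x) - z - ∫ v(s)² / (w₃(x, s) - z) ds` of the Schur complement. -/
noncomputable def schurSymbol (w₂ : C(X, ℝ)) (w₃ : C(X × Y, ℝ)) (v : C(Y, ℝ)) (z : ℂ)
    (hz : ∀ x, shiftC w₃ z x ≠ 0) : C(X, ℂ) :=
  shiftC w₂ z - fiberInt v v (invC (shiftC w₃ z) hz)

theorem integral_mul_inv_eq (v u : C(Y, ℝ)) (φ : Y → ℂ) :
    ∫ s, (v s : ℂ) * (u s : ℂ) * (φ s)⁻¹ = ∫ s, (v s : ℂ) * (u s : ℂ) / φ s := by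
  simp only [div_eq_mul_inv]

theorem integral_mul_self_inv_eq (v : C(Y, ℝ)) (φ : Y → ℂ) :
    ∫ s, (v s : ℂ) * (v s : ℂ) * (φ s)⁻¹ = ∫ s, (v s : ℂ) ^ 2 / φ s := by
  simp only [div_eq_mul_inv, sq]

theorem schurSymbol_apply (w₂ : C(X, ℝ)) (w₃ : C(X × Y, ℝ)) (v : C(Y, ℝ)) (z : ℂ)
    (hz : ∀ x, shiftC w₃ z x ≠ 0) (x : X) :
    schurSymbol w₂ w₃ v z hz x =
      (w₂ x : ℂ) - z - ∫ s, (v s : ℂ) ^ 2 / ((w₃ (x, s) : ℂ) - z) :=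
  congrArg (fun c => (w₂ x : ℂ) - z - c)
    (integral_mul_self_inv_eq v fun s => (w₃ (x, s) : ℂ) - z)

/-- `K` is a slot for the `v₂₁` or `v₂₂` interaction, and is `0` when there is none; this lets the
fibre and channel operators share one reduction. -/
theorem schur_complement_eq (w₂ : C(X, ℝ)) (K : L2 X →L[ℂ] L2 X) (w₃ : C(X × Y, ℝ)) (v : C(Y, ℝ))
    (z : ℂ) (hz : ∀ x, shiftC w₃ z x ≠ 0) :
    (mulOp w₂ - K) - z • 1 - annih v ∘L mulC (invC (shiftC w₃ z) hz) ∘L create v =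
      mulC (schurSymbol w₂ w₃ v z hz) - K := by
  rw [annih_mulC_create, schurSymbol, mulC_sub, ← mulOp_sub_eq_mulC]
  abel

theorem isUnit_block₂_mulOp_iff (w₂ : C(X, ℝ)) (K : L2 X →L[ℂ] L2 X) (w₃ : C(X × Y, ℝ))
    (v : C(Y, ℝ)) (z : ℂ) (hz : ∀ x, shiftC w₃ z x ≠ 0) :
    IsUnit (block₂ (mulOp w₂ - K) (annih v) (create v) (mulOp w₃) - z • 1) ↔
      IsUnit (mulC (schurSymbol w₂ w₃ v z hz) - K) := by
  rw [block₂_sub_smul_one, mulOp_sub_eq_mulC w₃,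
    isUnit_block₂_iff _ _ _ (mulC_invC_apply hz) (invC_mulC_apply hz), schur_complement_eq]

theorem isSingular_block₂_mulOp_of_schur (w₂ : C(X, ℝ)) (K : L2 X →L[ℂ] L2 X)
    (w₃ : C(X × Y, ℝ)) (v : C(Y, ℝ)) (z : ℂ) (hz : ∀ x, shiftC w₃ z x ≠ 0)
    (h : IsSingular (mulC (schurSymbol w₂ w₃ v z hz) - K)) :
    IsSingular (block₂ (mulOp w₂ - K) (annih v) (create v) (mulOp w₃) - z • 1) := by
  rw [block₂_sub_smul_one, mulOp_sub_eq_mulC w₃]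
  refine IsSingular.block₂_of_schur _ _ _ (mulC_invC_apply hz) ?_
  rwa [schur_complement_eq]

section Bordered

variable {E : Type*} [NormedAddCommGroup E] [NormedSpace ℂ E]

theorem isUnit_block₃_mulOp_iff [CompleteSpace E] (A : E →L[ℂ] E) (B : L2 X →L[ℂ] E)
    (C : E →L[ℂ] L2 X) (w₂ : C(X, ℝ)) (K : L2 X →L[ℂ] L2 X) (w₃ : C(X × Y, ℝ))
    (v : C(Y, ℝ)) (z : ℂ) (hz : ∀ x, shiftC w₃ z x ≠ 0) :
    IsUnit (block₃ A B C (mulOp w₂ - K) (annih v) (create v) (mulOp w₃) - z • 1) ↔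
      IsUnit (block₂ (A - z • 1) B C (mulC (schurSymbol w₂ w₃ v z hz) - K)) := by
  rw [block₃_sub_smul_one, mulOp_sub_eq_mulC w₃,
    isUnit_block₃_iff _ _ _ _ _ _ (mulC_invC_apply hz) (invC_mulC_apply hz), schur_complement_eq]

theorem isSingular_block₃_mulOp_of_schur (A : E →L[ℂ] E) (B : L2 X →L[ℂ] E)
    (C : E →L[ℂ] L2 X) (w₂ : C(X, ℝ)) (K : L2 X →L[ℂ] L2 X) (w₃ : C(X × Y, ℝ))
    (v : C(Y, ℝ)) (z : ℂ) (hz : ∀ x, shiftC w₃ z x ≠ 0)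
    (h : IsSingular (block₂ (A - z • 1) B C (mulC (schurSymbol w₂ w₃ v z hz) - K))) :
    IsSingular (block₃ A B C (mulOp w₂ - K) (annih v) (create v) (mulOp w₃) - z • 1) := by
  rw [block₃_sub_smul_one, mulOp_sub_eq_mulC w₃]
  refine IsSingular.block₃_of_schur _ _ _ _ _ _ (mulC_invC_apply hz) ?_
  rwa [schur_complement_eq]

end Bordered

/-! ### The reduced operators -/

theorem isUnit_smul_one_iff (c : ℂ) : IsUnit (c • (1 : ℂ →L[ℂ] ℂ)) ↔ c ≠ 0 := by
  rw [← Algebra.algebraMap_eq_smul_one]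
  exact ⟨fun h h0 => by simp [h0] at h, fun h => (IsUnit.mk0 c h).map _⟩

theorem isUnit_mulC_sub_create₀_iff {φ : C(Y, ℂ)} (h : ∀ y, φ y ≠ 0) (u : C(Y, ℝ)) :
    IsUnit (mulC φ - create₀ u ∘L annih₀ u) ↔ 1 - ∫ s, (u s : ℂ) ^ 2 / φ s ≠ 0 := by
  have e : ∀ c : ℂ, (1 : ℂ →L[ℂ] ℂ) - c • 1 = (1 - c) • 1 := fun c => by
    ext; simp
  rw [isUnit_sub_comp_iff (mulC_invC_apply h) (invC_mulC_apply h), annih₀_mulC_create₀, e,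
    isUnit_smul_one_iff, ← integral_mul_self_inv_eq]
  rfl

theorem isUnit_block₂_mulC_create₀_iff {φ : C(Y, ℂ)} (h : ∀ y, φ y ≠ 0) (a : ℂ) (u u' : C(Y, ℝ)) :
    IsUnit (block₂ (a • (1 : ℂ →L[ℂ] ℂ)) (annih₀ u) (create₀ u)
        (mulC φ - create₀ u' ∘L annih₀ u')) ↔
      (1 - ∫ s, (u' s : ℂ) ^ 2 / φ s) * (a - ∫ s, (u s : ℂ) ^ 2 / φ s) -
        (∫ s, (u s : ℂ) * (u' s : ℂ) / φ s) ^ 2 ≠ 0 := by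
  have hcomm : ∀ b c : ℂ, (b • (1 : ℂ →L[ℂ] ℂ)) * (c • 1) = (c • 1) * (b • 1) := by
    intro b c
    rw [smul_mul_smul_comm, smul_mul_smul_comm, mul_comm b]
  have e := isUnit_block₂_sub_comp_iff (a • (1 : ℂ →L[ℂ] ℂ)) (annih₀ u) (annih₀ u') (create₀ u)
    (create₀ u') (mulC_invC_apply h) (invC_mulC_apply h)
    (α := (a - ∫ s, (u s : ℂ) ^ 2 / φ s) • 1) (β := (∫ s, (u s : ℂ) * (u' s : ℂ) / φ s) • 1)
    (β' := (∫ s, (u s : ℂ) * (u' s : ℂ) / φ s) • 1)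
    (γ := (1 - ∫ s, (u' s : ℂ) ^ 2 / φ s) • 1)
    (by rw [annih₀_mulC_create₀, sub_smul, ← integral_mul_self_inv_eq]; rfl)
    (by rw [annih₀_mulC_create₀, ← integral_mul_inv_eq]; rfl)
    (by
      rw [annih₀_mulC_create₀, ← integral_mul_inv_eq]
      simp only [mul_comm (u _ : ℂ)]
      rfl)
    (by rw [annih₀_mulC_create₀, sub_smul, one_smul, ← integral_mul_self_inv_eq]; rfl)
    (hcomm _ _) (hcomm _ _) (hcomm _ _) (hcomm _ _) (hcomm _ _) (hcomm _ _)
  rw [e, smul_mul_smul_comm, smul_mul_smul_comm, ← sub_smul, mul_one, isUnit_smul_one_iff,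
    mul_comm (a - _), ← sq]

variable [∀ x : X, (𝓝[≠] x).NeBot] [∀ y : Y, (𝓝[≠] y).NeBot]
  [(volume : Measure X).IsOpenPosMeasure] [(volume : Measure Y).IsOpenPosMeasure]

theorem isSingular_block₂_of_mem_range (A : L2 X →L[ℂ] L2 X) {w₃ : C(X × Y, ℝ)} (v : C(Y, ℝ))
    {x : X × Y} {z : ℂ} (h : (w₃ x : ℂ) = z) :
    IsSingular (block₂ A (annih v) (create v) (mulOp w₃) - z • 1) := by
  rw [block₂_sub_smul_one, mulOp_sub_eq_mulC]
  -- Only one annihilation condition is needed, so `v` fills both slots.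
  exact IsSingular.block₂_of_ker _ _ _ (V := annihKer X v v) inf_le_left
    (isSingular_mulC_ker (z₀ := x) (sub_eq_zero.2 h) v v)

theorem isSingular_block₃_of_mem_range {E : Type*} [NormedAddCommGroup E] [NormedSpace ℂ E]
    (A : E →L[ℂ] E) (B : L2 X →L[ℂ] E) (C : E →L[ℂ] L2 X) (D : L2 X →L[ℂ] L2 X)
    {w₃ : C(X × Y, ℝ)} (v : C(Y, ℝ)) {x : X × Y} {z : ℂ} (h : (w₃ x : ℂ) = z) :
    IsSingular (block₃ A B C D (annih v) (create v) (mulOp w₃) - z • 1) := by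
  rw [block₃_sub_smul_one, mulOp_sub_eq_mulC]
  exact IsSingular.block₃_of_ker _ _ _ _ _ _ (V := annihKer X v v) inf_le_left
    (isSingular_mulC_ker (z₀ := x) (sub_eq_zero.2 h) v v)

theorem isSingular_mulC_sub_create₀ {φ : C(Y, ℂ)} {y : Y} (h : φ y = 0) (u : C(Y, ℝ)) :
    IsSingular (mulC φ - create₀ u ∘L annih₀ u) := by
  have := (isSingular_mulC h).add_comp (-create₀ u) (annih₀ u)
  rwa [ContinuousLinearMap.neg_comp, ← sub_eq_add_neg] at this

/-- The operator `f ↦ ((x, y) ↦ u(x) ∫ u(s) f(s, y) ds)`. -/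
noncomputable def createAnnihFst (u : C(X, ℝ)) : L2 (X × Y) →L[ℂ] L2 (X × Y) :=
  swapOp ∘L create u ∘L annih u ∘L swapOp

/-- The subtracted operator has rank one only for each fixed second variable, so finite-rank
stability is not available. The test functions are instead taken in its kernel; the swap moves the
integrated variable to second place, where `isSingular_mulC_ker` supplies them. -/
theorem isSingular_mulC_sub_createAnnihFst {φ : C(X × Y, ℂ)} {x : X × Y} (h : φ x = 0)
    (u : C(X, ℝ)) : IsSingular (mulC φ - createAnnihFst u) := by
  have h1 := isSingular_mulC_ker (φ := φ.comp ⟨Prod.swap, continuous_swap⟩) (z₀ := x.swap) h u u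
  refine IsSingular.of_comp_right (swapOp ∘L (annihKer Y u u).subtypeL) (fun f => ?_) ?_
  · exact (LinearIsometry.norm_map (Lp.compMeasurePreservingₗᵢ ℂ (Prod.swap : X × Y → Y × X)
      Measure.measurePreserving_swap) (f : L2 (Y × X))).ge
  · convert h1.comp_left swapOp using 1
    ext1 f
    have hf : annih u (f : L2 (Y × X)) = 0 := LinearMap.mem_ker.1 f.2.1
    change mulC φ (swapOp (f : L2 (Y × X))) -
      swapOp (create u (annih u (swapOp (swapOp (f : L2 (Y × X)))))) =
        swapOp (mulC (φ.comp ⟨Prod.swap, continuous_swap⟩) (f : L2 (Y × X)))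
    rw [swapOp_swapOp, hf, map_zero, map_zero, sub_zero, swapOp_mulC]
    rfl

/-- Here `1 - a M⁻¹ c` acts on functions of the conserved variable `y`, as multiplication by the
displayed function. -/
theorem isUnit_mulC_sub_createAnnihFst_iff {φ : C(X × Y, ℂ)} (h : ∀ x, φ x ≠ 0) (u : C(X, ℝ)) :
    IsUnit (mulC φ - createAnnihFst u) ↔ ∀ y, 1 - ∫ s, (u s : ℂ) ^ 2 / φ (s, y) ≠ 0 := by
  have e : (annih u ∘L swapOp) ∘L mulC (invC φ h) ∘L (swapOp ∘L create u) =
      mulC (fiberInt u u ((invC φ h).comp ⟨Prod.swap, continuous_swap⟩) : C(Y, ℂ)) := by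
    rw [← annih_mulC_create]
    ext1 f
    change annih u (swapOp (mulC (invC φ h) (swapOp (create u f)))) = _
    rw [swapOp_mulC, swapOp_swapOp]
    rfl
  change IsUnit (mulC φ - (swapOp ∘L create u) ∘L (annih u ∘L swapOp)) ↔ _
  rw [isUnit_sub_comp_iff (mulC_invC_apply h) (invC_mulC_apply h), e, ← mulC_one, ← mulC_sub,
    isUnit_mulC_iff]
  refine forall_congr' fun y => ?_
  rw [← integral_mul_self_inv_eq]
  rfl

theorem isSingular_block₂_mulC_create₀ {φ : C(Y, ℂ)} {y : Y} (h : φ y = 0) (A : ℂ →L[ℂ] ℂ)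
    (u u' : C(Y, ℝ)) :
    IsSingular (block₂ A (annih₀ u) (create₀ u) (mulC φ - create₀ u' ∘L annih₀ u')) :=
  (isSingular_mulC_sub_create₀ h u').block₂_of_finiteDimensional _ _ _

/-- Neither the border `L2 X` nor the perturbation can be treated as finite-dimensional, so test
functions must be killed by both `annih u` and `annih u'`; hence the two functions in `annihKer`. -/
theorem isSingular_block₂_mulC_create {φ : C(X × Y, ℂ)} {x : X × Y} (h : φ x = 0)
    (A : L2 X →L[ℂ] L2 X) (u u' : C(Y, ℝ)) :
    IsSingular (block₂ A (annih u) (create u) (mulC φ - create u' ∘L annih u')) := by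
  refine IsSingular.block₂_of_ker _ _ _ (V := annihKer X u u') inf_le_left ?_
  convert isSingular_mulC_ker (z₀ := x) h u u' using 1
  ext1 f
  have hf : annih u' (f : L2 (X × Y)) = 0 := LinearMap.mem_ker.1 f.2.2
  change mulC φ (f : L2 (X × Y)) - create u' (annih u' (f : L2 (X × Y))) =
    mulC φ (f : L2 (X × Y))
  rw [hf, map_zero, sub_zero]

/-- All four entries of the reduced 2×2 matrix are multiplication operators, so they commute and the
determinant is formed pointwise in `x`. -/
theorem isUnit_block₂_mulC_create_iff {φ : C(X × Y, ℂ)} (h : ∀ x, φ x ≠ 0) (ψ : C(X, ℂ))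
    (u u' : C(Y, ℝ)) :
    IsUnit (block₂ (mulC ψ) (annih u) (create u) (mulC φ - create u' ∘L annih u')) ↔
      ∀ x, (1 - ∫ s, (u' s : ℂ) ^ 2 / φ (x, s)) * (ψ x - ∫ s, (u s : ℂ) ^ 2 / φ (x, s)) -
        (∫ s, (u s : ℂ) * (u' s : ℂ) / φ (x, s)) ^ 2 ≠ 0 := by
  have hcomm : ∀ b c : C(X, ℂ), mulC b * mulC c = mulC c * mulC b := by
    intro b c
    rw [← mulC_mul, ← mulC_mul, mul_comm b]
  have e := isUnit_block₂_sub_comp_iff (mulC ψ) (annih u) (annih u') (create u)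
    (create u') (mulC_invC_apply h) (invC_mulC_apply h)
    (α := mulC (ψ - fiberInt u u (invC φ h))) (β := mulC (fiberInt u u' (invC φ h)))
    (β' := mulC (fiberInt u' u (invC φ h)))
    (γ := mulC (1 - fiberInt u' u' (invC φ h)))
    (by rw [annih_mulC_create, mulC_sub])
    (by rw [annih_mulC_create])
    (by rw [annih_mulC_create])
    (by rw [annih_mulC_create, mulC_sub, mulC_one])
    (hcomm _ _) (hcomm _ _) (hcomm _ _) (hcomm _ _) (hcomm _ _) (hcomm _ _)
  rw [e, ← mulC_mul, ← mulC_mul, ← mulC_sub, isUnit_mulC_iff]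
  refine forall_congr' fun x => ?_
  have e1 : fiberInt u' u (invC φ h) = fiberInt u u' (invC φ h) := by
    ext x
    simp only [fiberInt, ContinuousMap.coe_mk, mul_comm (u _ : ℂ)]
  rw [e1, mul_comm, ← sq, ← integral_mul_self_inv_eq, ← integral_mul_self_inv_eq,
    ← integral_mul_inv_eq]
  rfl

end Reduction

/-! ### The torus: determinants, fibres and channel operators -/

section Torus

variable {ν : ℕ}

/-- The place where `1 ≤ ν` enters: a connected T₁ space with more than one point has no isolated
points. -/
theorem torus_neBot_nhdsNE (hν : 1 ≤ ν) (x : Torus ν) : (𝓝[≠] x).NeBot := by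
  have : Nonempty (Fin ν) := ⟨⟨0, hν⟩⟩
  have : Nontrivial (AddCircle (2 * Real.pi)) := by
    refine ⟨⟨0, ((Real.pi : ℝ) : AddCircle (2 * Real.pi)), fun h => ?_⟩⟩
    obtain ⟨n, hn⟩ := (AddCircle.coe_eq_zero_iff _).1 h.symm
    rw [zsmul_eq_mul] at hn
    have h1 : ((n * 2 - 1 : ℤ) : ℝ) * Real.pi = 0 := by push_cast; linarith
    have h2 := (mul_eq_zero.1 h1).resolve_right Real.pi_ne_zero
    norm_cast at h2
    omega
  exact ConnectedSpace.neBot_nhdsWithin_compl_of_nontrivial_of_t1space x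

theorem prod_neBot_nhdsNE {X Y : Type*} [TopologicalSpace X] [TopologicalSpace Y]
    (h : ∀ x : X, (𝓝[≠] x).NeBot) (z : X × Y) : (𝓝[≠] z).NeBot := by
  have := h z.1
  rw [← mem_closure_iff_nhdsWithin_neBot, mem_closure_iff]
  intro U hU hz
  obtain ⟨A, B, hA, hB, hzA, hzB, hAB⟩ := isOpen_prod_iff.1 hU z.1 z.2 hz
  obtain ⟨x, hxA, hx⟩ := mem_closure_iff.1 (mem_closure_iff_nhdsWithin_neBot.2 this) A hA hzA
  exact ⟨(x, z.2), hAB ⟨hxA, hzB⟩, fun h => hx (congrArg Prod.fst h)⟩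

/-- By compactness and connectedness the range of `w₃` is the whole segment between its extrema. -/
theorem mem_sigmaFour_iff (w₃ : C((Torus ν × Torus ν) × Torus ν, ℝ)) (z : ℂ) :
    z ∈ sigmaFour w₃ ↔ ∃ x, (w₃ x : ℂ) = z := by
  have hc : IsCompact (Set.range w₃) := isCompact_range w₃.continuous
  have hne : (Set.range w₃).Nonempty := Set.range_nonempty _
  constructor
  · rintro ⟨r, hr, rfl⟩
    obtain ⟨x, hx⟩ := (isPreconnected_range w₃.continuous).Icc_subset
      (hc.sInf_mem hne) (hc.sSup_mem hne) hr
    exact ⟨x, by rw [hx]⟩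
  · rintro ⟨x, rfl⟩
    exact ⟨w₃ x, ⟨ciInf_le hc.bddBelow x, le_ciSup hc.bddAbove x⟩, rfl⟩

theorem shiftC_ne_zero {X : Type*} [TopologicalSpace X] [CompactSpace X]
    [SecondCountableTopology X] {w : C(X, ℝ)} {z : ℂ} (h : ∀ x, (w x : ℂ) ≠ z) (x : X) :
    shiftC w z x ≠ 0 := sub_ne_zero.2 (h x)

variable (w₁ v₂ v₃ v₂₁ v₂₂ : C(Torus ν, ℝ)) (w₂ : C(Torus ν × Torus ν, ℝ))
  (w₃ : C((Torus ν × Torus ν) × Torus ν, ℝ))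

/-! ### The Friedrichs model `h₃` -/

theorem isSelfAdjoint_ofReal_smul_id (r : ℝ) :
    IsSelfAdjoint ((r : ℂ) • ContinuousLinearMap.id ℂ ℂ) := by
  rw [ContinuousLinearMap.isSelfAdjoint_iff_isSymmetric]
  intro x y
  simp only [ContinuousLinearMap.coe_coe, _root_.smul_apply, ContinuousLinearMap.id_apply,
    smul_eq_mul, RCLike.inner_apply, map_mul, Complex.conj_ofReal]
  ring

theorem isSelfAdjoint_h3 (p q : Torus ν) : IsSelfAdjoint (h3 w₂ w₃ v₃ p q) :=
  isSelfAdjoint_block₂ (isSelfAdjoint_ofReal_smul_id _) (isSelfAdjoint_mulOp _)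
    fun x y => inner_annih₀ v₃ x y

theorem mem_essSpectrum_h3 (hν : 1 ≤ ν) {p q s : Torus ν} {z : ℂ}
    (h : (w₃ ((p, q), s) : ℂ) = z) : z ∈ essSpectrum (h3 w₂ w₃ v₃ p q) := by
  have := torus_neBot_nhdsNE hν
  refine IsSingular.mem_essSpectrum (isSelfAdjoint_h3 v₃ w₂ w₃ p q) ?_
  rw [h3, block₂_sub_smul_one, mulOp_sub_eq_mulC]
  exact (isSingular_mulC (x₀ := s) (sub_eq_zero.2 h)).block₂_of_finiteDimensional _ _ _

theorem mem_spectrum_h3_iff {p q : Torus ν} {z : ℂ} (h : ∀ s, (w₃ ((p, q), s) : ℂ) ≠ z) :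
    z ∈ spectrum ℂ (h3 w₂ w₃ v₃ p q) ↔ Δ3 w₂ w₃ v₃ p q z = 0 := by
  have hz : ∀ s, shiftC ⟨fun t => w₃ ((p, q), t), by fun_prop⟩ z s ≠ 0 :=
    fun s => sub_ne_zero.2 (h s)
  rw [mem_spectrum_iff_not_isUnit_sub, not_iff_comm, h3, block₂_sub_smul_one, mulOp_sub_eq_mulC,
    isUnit_block₂_iff _ _ _ (mulC_invC_apply hz) (invC_mulC_apply hz), annih₀_mulC_create₀]
  have e : (w₂ (p, q) : ℂ) • ContinuousLinearMap.id ℂ ℂ - z • 1 -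
      (∫ s, (v₃ s : ℂ) * (v₃ s : ℂ) * invC _ hz s) • 1 =
      Δ3 w₂ w₃ v₃ p q z • (1 : ℂ →L[ℂ] ℂ) := by
    rw [Δ3, ← integral_mul_self_inv_eq]
    exact ((sub_smul _ _ _).trans (congrArg (· - _) (sub_smul _ _ _))).symm
  rw [e, isUnit_smul_one_iff]

theorem mem_discSpectrum_h3 {p q : Torus ν} {z : ℂ} (h : ∀ s, (w₃ ((p, q), s) : ℂ) ≠ z)
    (hz : z ∈ spectrum ℂ (h3 w₂ w₃ v₃ p q)) : z ∈ discSpectrum (h3 w₂ w₃ v₃ p q) :=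
  mem_discSpectrum_block₂ (K := 0) (isSelfAdjoint_h3 v₃ w₂ w₃ p q) hz
    (isUnit_mulC fun s => sub_ne_zero.2 (h s)) isCompactOperator_zero
    ((mulOp_sub_eq_mulC _ _).trans (add_zero _).symm)

/-! ### The fibre operators `h₁` and `h₂` -/

theorem isSelfAdjoint_h1 (p : Torus ν) : IsSelfAdjoint (h1 w₂ w₃ v₂₁ v₃ p) :=
  isSelfAdjoint_block₂ ((isSelfAdjoint_mulOp _).sub (isSelfAdjoint_create₀_annih₀ _))
    (isSelfAdjoint_mulOp _) fun x y => inner_annih v₃ x y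

theorem isSelfAdjoint_h2 (p : Torus ν) : IsSelfAdjoint (h2 w₁ w₂ w₃ v₂ v₂₂ v₃ p) :=
  isSelfAdjoint_block₃ (isSelfAdjoint_ofReal_smul_id _)
    ((isSelfAdjoint_mulOp _).sub (isSelfAdjoint_create₀_annih₀ _))
    (isSelfAdjoint_mulOp _) (fun x y => inner_annih₀ v₂ x y) fun x y => inner_annih v₃ x y

theorem mem_essSpectrum_h1_of_range (hν : 1 ≤ ν) {p q s : Torus ν} {z : ℂ}
    (h : (w₃ ((q, p), s) : ℂ) = z) : z ∈ essSpectrum (h1 w₂ w₃ v₂₁ v₃ p) := by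
  have := torus_neBot_nhdsNE hν
  exact IsSingular.mem_essSpectrum (isSelfAdjoint_h1 v₃ v₂₁ w₂ w₃ p)
    (isSingular_block₂_of_mem_range _ v₃ (x := (q, s)) h)

theorem mem_essSpectrum_h2_of_range (hν : 1 ≤ ν) {p q s : Torus ν} {z : ℂ}
    (h : (w₃ ((p, q), s) : ℂ) = z) : z ∈ essSpectrum (h2 w₁ w₂ w₃ v₂ v₂₂ v₃ p) := by
  have := torus_neBot_nhdsNE hν
  exact IsSingular.mem_essSpectrum (isSelfAdjoint_h2 w₁ v₂ v₃ v₂₂ w₂ w₃ p)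
    (isSingular_block₃_of_mem_range _ _ _ _ v₃ (x := (q, s)) h)

theorem mem_essSpectrum_h1_of_Δ3 (hν : 1 ≤ ν) {p q : Torus ν} {z : ℂ}
    (h : ∀ q s, (w₃ ((q, p), s) : ℂ) ≠ z) (hΔ : Δ3 w₂ w₃ v₃ q p z = 0) :
    z ∈ essSpectrum (h1 w₂ w₃ v₂₁ v₃ p) := by
  have := torus_neBot_nhdsNE hν
  exact IsSingular.mem_essSpectrum (isSelfAdjoint_h1 v₃ v₂₁ w₂ w₃ p)
    (isSingular_block₂_mulOp_of_schur _ _ _ v₃ z (shiftC_ne_zero fun x => h x.1 x.2)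
      (isSingular_mulC_sub_create₀ (y := q) ((schurSymbol_apply _ _ _ _ _ _).trans hΔ) _))

theorem mem_essSpectrum_h2_of_Δ3 (hν : 1 ≤ ν) {p q : Torus ν} {z : ℂ}
    (h : ∀ q s, (w₃ ((p, q), s) : ℂ) ≠ z) (hΔ : Δ3 w₂ w₃ v₃ p q z = 0) :
    z ∈ essSpectrum (h2 w₁ w₂ w₃ v₂ v₂₂ v₃ p) := by
  have := torus_neBot_nhdsNE hν
  exact IsSingular.mem_essSpectrum (isSelfAdjoint_h2 w₁ v₂ v₃ v₂₂ w₂ w₃ p)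
    (isSingular_block₃_mulOp_of_schur _ _ _ _ _ _ v₃ z (shiftC_ne_zero fun x => h x.1 x.2)
      (isSingular_block₂_mulC_create₀ (y := q) ((schurSymbol_apply _ _ _ _ _ _).trans hΔ) _ _ _))

theorem mem_spectrum_h1_iff {p : Torus ν} {z : ℂ} (h : ∀ q s, (w₃ ((q, p), s) : ℂ) ≠ z)
    (hΔ : ∀ q, Δ3 w₂ w₃ v₃ q p z ≠ 0) :
    z ∈ spectrum ℂ (h1 w₂ w₃ v₂₁ v₃ p) ↔ Δ1 w₂ w₃ v₂₁ v₃ p z = 0 := by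
  have hz : ∀ x : Torus ν × Torus ν, shiftC ⟨fun x => w₃ ((x.1, p), x.2), by fun_prop⟩ z x ≠ 0 :=
    shiftC_ne_zero fun x => h x.1 x.2
  have hS : ∀ q, schurSymbol ⟨fun q => w₂ (q, p), by fun_prop⟩ _ v₃ z hz q =
    Δ3 w₂ w₃ v₃ q p z := schurSymbol_apply _ _ _ _ _
  rw [mem_spectrum_iff_not_isUnit_sub, not_iff_comm, h1, isUnit_block₂_mulOp_iff _ _ _ _ _ hz,
    isUnit_mulC_sub_create₀_iff fun q => (hS q).trans_ne (hΔ q)]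
  simp only [hS]
  rfl

theorem mem_spectrum_h2_iff {p : Torus ν} {z : ℂ} (h : ∀ q s, (w₃ ((p, q), s) : ℂ) ≠ z)
    (hΔ : ∀ q, Δ3 w₂ w₃ v₃ p q z ≠ 0) :
    z ∈ spectrum ℂ (h2 w₁ w₂ w₃ v₂ v₂₂ v₃ p) ↔ Δ2 w₁ w₂ w₃ v₂ v₂₂ v₃ p z = 0 := by
  have e : (w₁ p : ℂ) • ContinuousLinearMap.id ℂ ℂ - z • 1 =
      ((w₁ p : ℂ) - z) • (1 : ℂ →L[ℂ] ℂ) := (sub_smul _ _ _).symm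
  have hz : ∀ x : Torus ν × Torus ν, shiftC ⟨fun x => w₃ ((p, x.1), x.2), by fun_prop⟩ z x ≠ 0 :=
    shiftC_ne_zero fun x => h x.1 x.2
  have hS : ∀ q, schurSymbol ⟨fun q => w₂ (p, q), by fun_prop⟩ _ v₃ z hz q =
    Δ3 w₂ w₃ v₃ p q z := schurSymbol_apply _ _ _ _ _
  rw [mem_spectrum_iff_not_isUnit_sub, not_iff_comm, h2,
    isUnit_block₃_mulOp_iff _ _ _ _ _ _ _ _ hz, e,
    isUnit_block₂_mulC_create₀_iff fun q => (hS q).trans_ne (hΔ q)]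
  simp only [hS]
  rfl

/-- Supplies the invertible part in the splitting of `h1` and of the lower block of `h2`: without
the `v₂₁` or `v₂₂` term the Schur complement is multiplication by a function without zeros. -/
theorem isUnit_block₂_mulOp_fiber {w : C(Torus ν, ℝ)} {w' : C(Torus ν × Torus ν, ℝ)} {z : ℂ}
    (h : ∀ x, shiftC w' z x ≠ 0) (hΔ : ∀ q, schurSymbol w w' v₃ z h q ≠ 0) :
    IsUnit (block₂ (mulOp w) (annih v₃) (create v₃) (mulOp w') - z • 1) := by
  have e := isUnit_block₂_mulOp_iff w 0 w' v₃ z h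
  rw [sub_zero, sub_zero] at e
  exact e.2 (isUnit_mulC hΔ)

theorem mem_discSpectrum_h1 {p : Torus ν} {z : ℂ} (h : ∀ q s, (w₃ ((q, p), s) : ℂ) ≠ z)
    (hΔ : ∀ q, Δ3 w₂ w₃ v₃ q p z ≠ 0) (hz : z ∈ spectrum ℂ (h1 w₂ w₃ v₂₁ v₃ p)) :
    z ∈ discSpectrum (h1 w₂ w₃ v₂₁ v₃ p) :=
  mem_discSpectrum_of_eq_add (isSelfAdjoint_h1 v₃ v₂₁ w₂ w₃ p) hz
    (isUnit_block₂_mulOp_fiber v₃ (shiftC_ne_zero fun x => h x.1 x.2)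
      fun q => (schurSymbol_apply _ _ _ _ _ q).trans_ne (hΔ q))
    (isCompactOperator_block₂_neg_comp _ _) (block₂_sub_comp_eq_add _ _ _ _ _ _ _)

theorem mem_discSpectrum_h2 {p : Torus ν} {z : ℂ} (h : ∀ q s, (w₃ ((p, q), s) : ℂ) ≠ z)
    (hΔ : ∀ q, Δ3 w₂ w₃ v₃ p q z ≠ 0) (hz : z ∈ spectrum ℂ (h2 w₁ w₂ w₃ v₂ v₂₂ v₃ p)) :
    z ∈ discSpectrum (h2 w₁ w₂ w₃ v₂ v₂₂ v₃ p) :=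
  mem_discSpectrum_block₂ (isSelfAdjoint_h2 w₁ v₂ v₃ v₂₂ w₂ w₃ p) hz
    (isUnit_block₂_mulOp_fiber v₃ (shiftC_ne_zero fun x => h x.1 x.2)
      fun q => (schurSymbol_apply _ _ _ _ _ q).trans_ne (hΔ q))
    (isCompactOperator_block₂_neg_comp _ _) (block₂_sub_comp_eq_add _ _ _ _ _ _ _)

theorem denominators_ne_zero_h1 (hν : 1 ≤ ν) {p : Torus ν} {z : ℂ}
    (hz : z ∉ essSpectrum (h1 w₂ w₃ v₂₁ v₃ p)) :
    (∀ q s, (w₃ ((q, p), s) : ℂ) ≠ z) ∧ ∀ q, Δ3 w₂ w₃ v₃ q p z ≠ 0 := by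
  have h : ∀ q s, (w₃ ((q, p), s) : ℂ) ≠ z :=
    fun q s h => hz (mem_essSpectrum_h1_of_range v₃ v₂₁ w₂ w₃ hν h)
  exact ⟨h, fun q hq => hz (mem_essSpectrum_h1_of_Δ3 v₃ v₂₁ w₂ w₃ hν h hq)⟩

theorem denominators_ne_zero_h2 (hν : 1 ≤ ν) {p : Torus ν} {z : ℂ}
    (hz : z ∉ essSpectrum (h2 w₁ w₂ w₃ v₂ v₂₂ v₃ p)) :
    (∀ q s, (w₃ ((p, q), s) : ℂ) ≠ z) ∧ ∀ q, Δ3 w₂ w₃ v₃ p q z ≠ 0 := by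
  have h : ∀ q s, (w₃ ((p, q), s) : ℂ) ≠ z :=
    fun q s h => hz (mem_essSpectrum_h2_of_range w₁ v₂ v₃ v₂₂ w₂ w₃ hν h)
  exact ⟨h, fun q hq => hz (mem_essSpectrum_h2_of_Δ3 w₁ v₂ v₃ v₂₂ w₂ w₃ hν h hq)⟩

theorem notMem_essSpectrum_h3 {p q : Torus ν} {z : ℂ} (h : ∀ s, (w₃ ((p, q), s) : ℂ) ≠ z) :
    z ∉ essSpectrum (h3 w₂ w₃ v₃ p q) :=
  fun hz => hz.2 (mem_discSpectrum_h3 v₃ w₂ w₃ h hz.1)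

/-- Off the essential spectrum, being spectral and being discrete coincide, so a determinant
detecting the spectrum there suffices. -/
theorem discSpectrum_eq_of_notMem_essSpectrum {E : Type*} [NormedAddCommGroup E]
    [NormedSpace ℂ E] (A : E →L[ℂ] E) (Δ : ℂ → ℂ)
    (h : ∀ z, z ∉ essSpectrum A → (z ∈ spectrum ℂ A ↔ Δ z = 0)) :
    discSpectrum A = {z | z ∉ essSpectrum A ∧ Δ z = 0} := by
  ext z
  constructor
  · intro hz
    have hess : z ∉ essSpectrum A := fun h => h.2 hz
    exact ⟨hess, (h z hess).1 hz.1⟩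
  · rintro ⟨hess, hΔ⟩
    by_contra hd
    exact hess ⟨(h z hess).2 hΔ, hd⟩

/-! ### The channel operators -/

theorem mem_spectrum_H1_of_range (hν : 1 ≤ ν) {x : (Torus ν × Torus ν) × Torus ν} {z : ℂ}
    (h : (w₃ x : ℂ) = z) : z ∈ spectrum ℂ (H1 w₂ w₃ v₂₁ v₃) := by
  have := torus_neBot_nhdsNE hν
  have := prod_neBot_nhdsNE (Y := Torus ν) this
  exact (mem_spectrum_iff_not_isUnit_sub _ _).2
    (isSingular_block₂_of_mem_range _ v₃ h).not_isUnit

theorem mem_spectrum_H2_of_range (hν : 1 ≤ ν) {x : (Torus ν × Torus ν) × Torus ν} {z : ℂ}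
    (h : (w₃ x : ℂ) = z) : z ∈ spectrum ℂ (H2 w₁ w₂ w₃ v₂ v₂₂ v₃) := by
  have := torus_neBot_nhdsNE hν
  have := prod_neBot_nhdsNE (Y := Torus ν) this
  exact (mem_spectrum_iff_not_isUnit_sub _ _).2
    (isSingular_block₃_of_mem_range _ _ _ _ v₃ h).not_isUnit

theorem mem_spectrum_H3_of_range (hν : 1 ≤ ν) {x : (Torus ν × Torus ν) × Torus ν} {z : ℂ}
    (h : (w₃ x : ℂ) = z) : z ∈ spectrum ℂ (H3 w₂ w₃ v₃) := by
  have := torus_neBot_nhdsNE hν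
  have := prod_neBot_nhdsNE (Y := Torus ν) this
  exact (mem_spectrum_iff_not_isUnit_sub _ _).2
    (isSingular_block₂_of_mem_range _ v₃ h).not_isUnit

theorem schurSymbol_eq_Δ3 {z : ℂ} (hz : ∀ x, shiftC w₃ z x ≠ 0) (x : Torus ν × Torus ν) :
    schurSymbol w₂ w₃ v₃ z hz x = Δ3 w₂ w₃ v₃ x.1 x.2 z := schurSymbol_apply _ _ _ _ _ _

theorem mem_spectrum_H3_iff (hν : 1 ≤ ν) {z : ℂ} (h : ∀ x, (w₃ x : ℂ) ≠ z) :
    z ∈ spectrum ℂ (H3 w₂ w₃ v₃) ↔ ∃ p q, Δ3 w₂ w₃ v₃ p q z = 0 := by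
  have := torus_neBot_nhdsNE hν
  have := prod_neBot_nhdsNE (Y := Torus ν) this
  have e := isUnit_block₂_mulOp_iff w₂ 0 w₃ v₃ z (shiftC_ne_zero h)
  rw [sub_zero, sub_zero, isUnit_mulC_iff] at e
  rw [mem_spectrum_iff_not_isUnit_sub, H3, e]
  simp only [schurSymbol_eq_Δ3, not_forall, not_not, Prod.exists]

theorem mem_spectrum_H1_of_Δ3 (hν : 1 ≤ ν) {z : ℂ} (h : ∀ x, (w₃ x : ℂ) ≠ z) {p q : Torus ν}
    (hΔ : Δ3 w₂ w₃ v₃ p q z = 0) : z ∈ spectrum ℂ (H1 w₂ w₃ v₂₁ v₃) := by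
  have := torus_neBot_nhdsNE hν
  have := prod_neBot_nhdsNE (Y := Torus ν) this
  exact (mem_spectrum_iff_not_isUnit_sub _ _).2
    (isSingular_block₂_mulOp_of_schur _ _ _ v₃ z (shiftC_ne_zero h)
      (isSingular_mulC_sub_createAnnihFst (x := (p, q))
        ((schurSymbol_apply _ _ _ _ _ _).trans hΔ) v₂₁)).not_isUnit

theorem mem_spectrum_H2_of_Δ3 (hν : 1 ≤ ν) {z : ℂ} (h : ∀ x, (w₃ x : ℂ) ≠ z) {p q : Torus ν}
    (hΔ : Δ3 w₂ w₃ v₃ p q z = 0) : z ∈ spectrum ℂ (H2 w₁ w₂ w₃ v₂ v₂₂ v₃) := by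
  have := torus_neBot_nhdsNE hν
  have := prod_neBot_nhdsNE (Y := Torus ν) this
  exact (mem_spectrum_iff_not_isUnit_sub _ _).2
    (isSingular_block₃_mulOp_of_schur _ _ _ _ _ _ v₃ z (shiftC_ne_zero h)
      (isSingular_block₂_mulC_create (x := (p, q))
        ((schurSymbol_apply _ _ _ _ _ _).trans hΔ) _ _ _)).not_isUnit

theorem mem_spectrum_H1_iff (hν : 1 ≤ ν) {z : ℂ} (h : ∀ x, (w₃ x : ℂ) ≠ z)
    (hΔ : ∀ p q, Δ3 w₂ w₃ v₃ p q z ≠ 0) :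
    z ∈ spectrum ℂ (H1 w₂ w₃ v₂₁ v₃) ↔ ∃ p, Δ1 w₂ w₃ v₂₁ v₃ p z = 0 := by
  have := torus_neBot_nhdsNE hν
  have hS := schurSymbol_eq_Δ3 v₃ w₂ w₃ (shiftC_ne_zero h)
  have e := (isUnit_block₂_mulOp_iff w₂ (createAnnihFst v₂₁) w₃ v₃ z (shiftC_ne_zero h)).trans
    (isUnit_mulC_sub_createAnnihFst_iff (fun x => (hS x).trans_ne (hΔ x.1 x.2)) v₂₁)
  rw [mem_spectrum_iff_not_isUnit_sub]
  -- `H1` unfolds to the operator in `e`, since `V21 v₂₁` and `createAnnihFst v₂₁` are the same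
  -- composition.
  refine (not_congr e).trans ?_
  simp only [hS, not_forall, not_not]
  rfl

theorem mem_spectrum_H2_iff (hν : 1 ≤ ν) {z : ℂ} (h : ∀ x, (w₃ x : ℂ) ≠ z)
    (hΔ : ∀ p q, Δ3 w₂ w₃ v₃ p q z ≠ 0) :
    z ∈ spectrum ℂ (H2 w₁ w₂ w₃ v₂ v₂₂ v₃) ↔ ∃ p, Δ2 w₁ w₂ w₃ v₂ v₂₂ v₃ p z = 0 := by
  have := torus_neBot_nhdsNE hν
  have hS := schurSymbol_eq_Δ3 v₃ w₂ w₃ (shiftC_ne_zero h)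
  rw [mem_spectrum_iff_not_isUnit_sub, H2, V22,
    isUnit_block₃_mulOp_iff _ _ _ _ _ _ _ _ (shiftC_ne_zero h), mulOp_sub_eq_mulC,
    isUnit_block₂_mulC_create_iff fun x => (hS x).trans_ne (hΔ x.1 x.2)]
  simp only [hS, not_forall, not_not]
  rfl

/-- If `z` is a value of `w₃`, it lies in both sides whatever `Δ3` evaluates to there. Otherwise all
`Δ3(p, q; z)` have nonvanishing denominators, and the spectrum of `h3` at `z` is discrete. -/
theorem sigmaThree_union_sigmaFour_eq :
    sigmaThree w₂ w₃ v₃ ∪ sigmaFour w₃ =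
      {z | (∃ x, (w₃ x : ℂ) = z) ∨ ∃ p q, Δ3 w₂ w₃ v₃ p q z = 0} := by
  ext z
  by_cases h : ∃ x, (w₃ x : ℂ) = z
  · exact iff_of_true (Or.inr ((mem_sigmaFour_iff w₃ z).2 h)) (Or.inl h)
  · have h' : ∀ x, (w₃ x : ℂ) ≠ z := fun x hx => h ⟨x, hx⟩
    simp only [Set.mem_union, mem_sigmaFour_iff, h, or_false, sigmaThree, Set.mem_iUnion,
      Set.mem_ofPred_eq, false_or]
    refine exists_congr fun p => exists_congr fun q => ?_
    rw [← mem_spectrum_h3_iff v₃ w₂ w₃ fun s => h' _]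
    exact ⟨fun hz => hz.1, mem_discSpectrum_h3 v₃ w₂ w₃ fun s => h' _⟩

/-- Values of `w₃` and zeros of `Δ3` belong to both sides, whatever the two-particle branch is. At
the remaining `z` both `H1` and the fibres `h1(p)` are governed by `Δ1(p; z)`. -/
theorem spectrum_H1_eq (hν : 1 ≤ ν) :
    spectrum ℂ (H1 w₂ w₃ v₂₁ v₃) =
      sigmaTwoH1 w₂ w₃ v₂₁ v₃ ∪ sigmaThree w₂ w₃ v₃ ∪ sigmaFour w₃ := by
  rw [Set.union_assoc, sigmaThree_union_sigmaFour_eq]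
  ext z
  by_cases h : ∃ x, (w₃ x : ℂ) = z
  · obtain ⟨x, hx⟩ := h
    exact iff_of_true (mem_spectrum_H1_of_range v₃ v₂₁ w₂ w₃ hν hx) (Or.inr (Or.inl ⟨x, hx⟩))
  have h' : ∀ x, (w₃ x : ℂ) ≠ z := fun x hx => h ⟨x, hx⟩
  by_cases hΔ : ∃ p q, Δ3 w₂ w₃ v₃ p q z = 0
  · obtain ⟨p, q, hpq⟩ := hΔ
    exact iff_of_true (mem_spectrum_H1_of_Δ3 v₃ v₂₁ w₂ w₃ hν h' hpq)
      (Or.inr (Or.inr ⟨p, q, hpq⟩))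
  have hΔ' : ∀ p q, Δ3 w₂ w₃ v₃ p q z ≠ 0 := fun p q hpq => hΔ ⟨p, q, hpq⟩
  rw [mem_spectrum_H1_iff v₃ v₂₁ w₂ w₃ hν h' hΔ']
  simp only [Set.mem_union, Set.mem_ofPred_eq, h, hΔ, or_false, sigmaTwoH1, Set.mem_iUnion]
  refine exists_congr fun p => ?_
  rw [← mem_spectrum_h1_iff v₃ v₂₁ w₂ w₃ (fun q s => h' _) fun q => hΔ' q p]
  exact ⟨mem_discSpectrum_h1 v₃ v₂₁ w₂ w₃ (fun q s => h' _) fun q => hΔ' q p, fun hz => hz.1⟩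

theorem spectrum_H2_eq (hν : 1 ≤ ν) :
    spectrum ℂ (H2 w₁ w₂ w₃ v₂ v₂₂ v₃) =
      sigmaTwoH2 w₁ w₂ w₃ v₂ v₂₂ v₃ ∪ sigmaThree w₂ w₃ v₃ ∪ sigmaFour w₃ := by
  rw [Set.union_assoc, sigmaThree_union_sigmaFour_eq]
  ext z
  by_cases h : ∃ x, (w₃ x : ℂ) = z
  · obtain ⟨x, hx⟩ := h
    exact iff_of_true (mem_spectrum_H2_of_range w₁ v₂ v₃ v₂₂ w₂ w₃ hν hx)
      (Or.inr (Or.inl ⟨x, hx⟩))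
  have h' : ∀ x, (w₃ x : ℂ) ≠ z := fun x hx => h ⟨x, hx⟩
  by_cases hΔ : ∃ p q, Δ3 w₂ w₃ v₃ p q z = 0
  · obtain ⟨p, q, hpq⟩ := hΔ
    exact iff_of_true (mem_spectrum_H2_of_Δ3 w₁ v₂ v₃ v₂₂ w₂ w₃ hν h' hpq)
      (Or.inr (Or.inr ⟨p, q, hpq⟩))
  have hΔ' : ∀ p q, Δ3 w₂ w₃ v₃ p q z ≠ 0 := fun p q hpq => hΔ ⟨p, q, hpq⟩
  rw [mem_spectrum_H2_iff w₁ v₂ v₃ v₂₂ w₂ w₃ hν h' hΔ']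
  simp only [Set.mem_union, Set.mem_ofPred_eq, h, hΔ, or_false, sigmaTwoH2, Set.mem_iUnion]
  refine exists_congr fun p => ?_
  rw [← mem_spectrum_h2_iff w₁ v₂ v₃ v₂₂ w₂ w₃ (fun q s => h' _) fun q => hΔ' p q]
  exact ⟨mem_discSpectrum_h2 w₁ v₂ v₃ v₂₂ w₂ w₃ (fun q s => h' _) fun q => hΔ' p q,
    fun hz => hz.1⟩

theorem spectrum_H3_eq (hν : 1 ≤ ν) :
    spectrum ℂ (H3 w₂ w₃ v₃) = sigmaThree w₂ w₃ v₃ ∪ sigmaFour w₃ := by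
  rw [sigmaThree_union_sigmaFour_eq]
  ext z
  by_cases h : ∃ x, (w₃ x : ℂ) = z
  · obtain ⟨x, hx⟩ := h
    exact iff_of_true (mem_spectrum_H3_of_range v₃ w₂ w₃ hν hx) (Or.inl ⟨x, hx⟩)
  · rw [mem_spectrum_H3_iff v₃ w₂ w₃ hν fun x hx => h ⟨x, hx⟩, Set.mem_ofPred_eq, or_iff_right h]

end Torus

end FockModel

theorem theorem3p1 (ν : ℕ) (hν : 1 ≤ ν)
    (w₁ v₂ v₃ v₂₁ v₂₂ : C(FockModel.Torus ν, ℝ))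
    (w₂ : C(FockModel.Torus ν × FockModel.Torus ν, ℝ))
    (w₃ : C((FockModel.Torus ν × FockModel.Torus ν) × FockModel.Torus ν, ℝ)) :
    -- the branches of the spectra of the channel operators
    (spectrum ℂ (FockModel.H1 w₂ w₃ v₂₁ v₃) =
        FockModel.sigmaTwoH1 w₂ w₃ v₂₁ v₃ ∪ FockModel.sigmaThree w₂ w₃ v₃ ∪
          FockModel.sigmaFour w₃) ∧
    (spectrum ℂ (FockModel.H2 w₁ w₂ w₃ v₂ v₂₂ v₃) =
        FockModel.sigmaTwoH2 w₁ w₂ w₃ v₂ v₂₂ v₃ ∪ FockModel.sigmaThree w₂ w₃ v₃ ∪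
          FockModel.sigmaFour w₃) ∧
    (spectrum ℂ (FockModel.H3 w₂ w₃ v₃) =
        FockModel.sigmaThree w₂ w₃ v₃ ∪ FockModel.sigmaFour w₃) ∧
    -- outside the essential spectra, the denominators in the determinants do not vanish
    (∀ (p q : FockModel.Torus ν) (z : ℂ),
        z ∉ FockModel.essSpectrum (FockModel.h3 w₂ w₃ v₃ p q) →
        ∀ s : FockModel.Torus ν, (w₃ ((p, q), s) : ℂ) ≠ z) ∧
    (∀ (p : FockModel.Torus ν) (z : ℂ),
        z ∉ FockModel.essSpectrum (FockModel.h1 w₂ w₃ v₂₁ v₃ p) →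
        ∀ s : FockModel.Torus ν, z ∉ FockModel.essSpectrum (FockModel.h3 w₂ w₃ v₃ s p) ∧
          FockModel.Δ3 w₂ w₃ v₃ s p z ≠ 0) ∧
    (∀ (p : FockModel.Torus ν) (z : ℂ),
        z ∉ FockModel.essSpectrum (FockModel.h2 w₁ w₂ w₃ v₂ v₂₂ v₃ p) →
        ∀ s : FockModel.Torus ν, z ∉ FockModel.essSpectrum (FockModel.h3 w₂ w₃ v₃ p s) ∧
          FockModel.Δ3 w₂ w₃ v₃ p s z ≠ 0) ∧
    -- the discrete spectra are the zero sets of the determinants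
    (∀ p q : FockModel.Torus ν, FockModel.discSpectrum (FockModel.h3 w₂ w₃ v₃ p q) =
        {z : ℂ | z ∉ FockModel.essSpectrum (FockModel.h3 w₂ w₃ v₃ p q) ∧
          FockModel.Δ3 w₂ w₃ v₃ p q z = 0}) ∧
    (∀ p : FockModel.Torus ν, FockModel.discSpectrum (FockModel.h1 w₂ w₃ v₂₁ v₃ p) =
        {z : ℂ | z ∉ FockModel.essSpectrum (FockModel.h1 w₂ w₃ v₂₁ v₃ p) ∧
          FockModel.Δ1 w₂ w₃ v₂₁ v₃ p z = 0}) ∧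
    (∀ p : FockModel.Torus ν, FockModel.discSpectrum (FockModel.h2 w₁ w₂ w₃ v₂ v₂₂ v₃ p) =
        {z : ℂ | z ∉ FockModel.essSpectrum (FockModel.h2 w₁ w₂ w₃ v₂ v₂₂ v₃ p) ∧
          FockModel.Δ2 w₁ w₂ w₃ v₂ v₂₂ v₃ p z = 0}) := by
  open FockModel in
  exact ⟨spectrum_H1_eq v₃ v₂₁ w₂ w₃ hν, spectrum_H2_eq w₁ v₂ v₃ v₂₂ w₂ w₃ hν,
    spectrum_H3_eq v₃ w₂ w₃ hν,
    fun p q z hz s h => hz (mem_essSpectrum_h3 v₃ w₂ w₃ hν h),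
    fun p z hz s => ⟨notMem_essSpectrum_h3 v₃ w₂ w₃
        ((denominators_ne_zero_h1 v₃ v₂₁ w₂ w₃ hν hz).1 s),
      (denominators_ne_zero_h1 v₃ v₂₁ w₂ w₃ hν hz).2 s⟩,
    fun p z hz s => ⟨notMem_essSpectrum_h3 v₃ w₂ w₃
        ((denominators_ne_zero_h2 w₁ v₂ v₃ v₂₂ w₂ w₃ hν hz).1 s),
      (denominators_ne_zero_h2 w₁ v₂ v₃ v₂₂ w₂ w₃ hν hz).2 s⟩,
    fun p q => discSpectrum_eq_of_notMem_essSpectrum _ _ fun z hz =>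
      mem_spectrum_h3_iff v₃ w₂ w₃ fun s h => hz (mem_essSpectrum_h3 v₃ w₂ w₃ hν h),
    fun p => discSpectrum_eq_of_notMem_essSpectrum _ _ fun z hz =>
      mem_spectrum_h1_iff v₃ v₂₁ w₂ w₃ (denominators_ne_zero_h1 v₃ v₂₁ w₂ w₃ hν hz).1
        (denominators_ne_zero_h1 v₃ v₂₁ w₂ w₃ hν hz).2,
    fun p => discSpectrum_eq_of_notMem_essSpectrum _ _ fun z hz =>
      mem_spectrum_h2_iff w₁ v₂ v₃ v₂₂ w₂ w₃
        (denominators_ne_zero_h2 w₁ v₂ v₃ v₂₂ w₂ w₃ hν hz).1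
        (denominators_ne_zero_h2 w₁ v₂ v₃ v₂₂ w₂ w₃ hν hz).2⟩
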